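/- Let $d,N\in\mathbb{N}$ with $N\ge 1$. For a finite set $\Lambda\subset\mathbb{Z}^d$ let $\mathcal{A}_\Lambda=\bigotimes_{x\in\Lambda}M_N(\mathbb{C})$ be the algebra of operators on $\bigotimes_{x\in\Lambda}\mathbb{C}^N$ with the operator norm, where $A\in\mathcal{A}_\Lambda$ is identified with $A\otimes 1\in\mathcal{A}_{\Lambda'}$ for $\Lambda\subset\Lambda'$; let $\mathcal{A}_0=\bigcup_\Lambda\mathcal{A}_\Lambda$ be the algebra of local observables and let the $C^*$-algebra $\mathcal{A}$ of quasi-local observables be its norm completion. Let $\Phi=(\Phi_X)$ be an interaction, that is, a family of hermitian operators $\Phi_X\in\mathcal{A}_X$ indexed by the finite sets $X\subset\mathbb{Z}^d$; for $r\ge1$ set $$\|\Phi\|_r=\sup_{x\in\mathbb{Z}^d}\sum_{X\ni x}\|\Phi_X\|\,r^{|X|}\in[0,\infty],$$ and assume that $\|\Phi\|_r<\infty$ for some $r>1$. For finite $\Lambda$ put $H_\Lambda=\sum_{X\subset\Lambda}\Phi_X$ and $\alpha^\Lambda_t(A)=e^{itH_\Lambda}Ae^{-itH_\Lambda}$. Let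 $\beta\ge0$ and suppose that $$\beta\,\|\Phi\|_{N+1}<\frac1{2N},$$ or, more generally, that $2\beta\,\|\Phi\|_{N(1+s)}<s$ for some $s<1/N$. Then there is exactly one one-parameter group $(\alpha_t)_{t\in\mathbb{R}}$ of $*$-automorphisms of $\mathcal{A}$ such that $\|\alpha_t^{\Lambda_n}(A)-\alpha_t(A)\|\to0$ for all $t\in\mathbb{R}$, all $A\in\mathcal{A}_0$ and all sequences $(\Lambda_n)$ of finite sets such that every finite set is contained in $\Lambda_n$ for all large $n$; and there is exactly one KMS state for $(\alpha_t)$ at inverse temperature $\beta$. Here a KMS state at inverse temperature $\beta$ is a bounded, positive, normalized linear functional $\rho$ on $\mathcal{A}$ such that, for every $A\in\mathcal{A}_0$, the function $t\mapsto\alpha_t(A)$ has an analytic continuation to a neighbourhood of the strip $0\le\operatorname{Im}z\le\beta$, and its value $\alpha_{i\beta}(A)$ at $i\beta$ satisfies $\rho(AB)=\rho(B\,\alpha_{i\beta}(A))$ for all $B\in\mathcal{A}_0$. -/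

import Mathlib

open scoped NNReal ENNReal

noncomputable section

namespace QuantumLattice

open scoped Kronecker Matrix.Norms.L2Operator ComplexOrder
open UniformSpace Filter Topology

universe u

variable {L : Type u} [DecidableEq L] {N : ℕ}

/-- The algebra `𝒜_Λ` of all operators on `⨂_{x ∈ Λ} ℂ^N`, as matrices in the product basis, which is
indexed by the configurations `Λ → Fin N`. It carries the operator norm. -/
abbrev BoxAlgebra (N : ℕ) (Λ : Finset L) : Type u :=
  Matrix (Λ → Fin N) (Λ → Fin N) ℂ

/-- A configuration in `Λ'` is a configuration in `Λ ⊆ Λ'` and one in `Λ' \ Λ`. -/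
def splitConfig {Λ Λ' : Finset L} (h : Λ ≤ Λ') :
    (Λ' → Fin N) ≃ (Λ → Fin N) × ({x : Λ' // x.1 ∉ Λ} → Fin N) where
  toFun σ := (fun x => σ ⟨x.1, h x.2⟩, fun x => σ x.1)
  invFun p x := if hx : x.1 ∈ Λ then p.1 ⟨x.1, hx⟩ else p.2 ⟨x, hx⟩
  left_inv σ := by
    funext x
    by_cases hx : x.1 ∈ Λ <;> simp [hx]
  right_inv p := by
    refine Prod.ext ?_ ?_
    · funext x
      simp
    · funext x
      simp [x.2]

/-- The inclusion `𝒜_Λ → 𝒜_Λ'`, `A ↦ A ⊗ 1`, for `Λ ⊆ Λ'`. -/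
def extend {Λ Λ' : Finset L} (h : Λ ≤ Λ') : BoxAlgebra N Λ →⋆ₐ[ℂ] BoxAlgebra N Λ' where
  toFun A := (A ⊗ₖ (1 : Matrix ({x : Λ' // x.1 ∉ Λ} → Fin N) _ ℂ)).submatrix
    (splitConfig h) (splitConfig h)
  map_one' := by
    rw [Matrix.one_kronecker_one, Matrix.submatrix_one_equiv]
  map_mul' A B := by
    rw [Matrix.submatrix_mul_equiv, ← Matrix.mul_kronecker_mul, one_mul]
  map_zero' := by
    rw [Matrix.zero_kronecker]; rfl
  map_add' A B := by
    rw [Matrix.add_kronecker]; rfl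
  commutes' c := by
    simp only [Algebra.algebraMap_eq_smul_one, Matrix.smul_kronecker, Matrix.one_kronecker_one]
    ext σ τ
    simp [Matrix.one_apply]
  map_star' A := by
    rw [Matrix.star_eq_conjTranspose, Matrix.star_eq_conjTranspose, Matrix.conjTranspose_submatrix,
      Matrix.conjTranspose_kronecker, Matrix.conjTranspose_one]

theorem extend_apply {Λ Λ' : Finset L} (h : Λ ≤ Λ') (A : BoxAlgebra N Λ) (σ τ : Λ' → Fin N) :
    extend h A σ τ =
      if ∀ x : Λ', x.1 ∉ Λ → σ x = τ x then
        A (fun x => σ ⟨x.1, h x.2⟩) (fun x => τ ⟨x.1, h x.2⟩) else 0 := by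
  have : ((fun x : {x : Λ' // x.1 ∉ Λ} => σ x.1) = fun x => τ x.1) ↔
      ∀ x : Λ', x.1 ∉ Λ → σ x = τ x := by
    rw [funext_iff]; simp
  change (A ⊗ₖ (1 : Matrix ({x : Λ' // x.1 ∉ Λ} → Fin N) _ ℂ))
    (splitConfig h σ) (splitConfig h τ) = _
  simp only [Matrix.kroneckerMap_apply, splitConfig, Equiv.coe_fn_mk,
    Matrix.one_apply, this, mul_ite, mul_one, mul_zero]

instance : DirectedSystem (fun Λ : Finset L => BoxAlgebra N Λ) fun _ _ h => extend h where
  map_self Λ A := by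
    ext σ τ
    rw [extend_apply, if_pos (fun x hx => absurd x.2 hx)]
  map_map Λ₃ Λ₂ Λ₁ h₁ h₂ A := by
    ext σ τ
    simp only [extend_apply]
    by_cases hσ : ∀ x : Λ₃, x.1 ∉ Λ₁ → σ x = τ x
    · rw [if_pos hσ, if_pos (fun x hx => hσ x fun h => hx (h₁ h))]
      exact if_pos fun (x : Λ₂) hx => hσ ⟨x.1, h₂ x.2⟩ hx
    · rw [if_neg hσ]
      split_ifs with h₃ h₄
      · refine absurd (fun x hx => ?_) hσ
        by_cases hx2 : x.1 ∈ Λ₂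
        · exact h₄ ⟨x.1, hx2⟩ hx
        · exact h₃ x hx2
      · rfl
      · rfl

theorem extend_injective [NeZero N] {Λ Λ' : Finset L} (h : Λ ≤ Λ') :
    Function.Injective (extend (N := N) h) := by
  intro A B hAB
  ext σ τ
  have key := congrFun (congrFun hAB ((splitConfig h).symm (σ, fun _ => 0)))
    ((splitConfig h).symm (τ, fun _ => 0))
  change (A ⊗ₖ (1 : Matrix ({x : Λ' // x.1 ∉ Λ} → Fin N) _ ℂ))
      (splitConfig h _) (splitConfig h _) =
    (B ⊗ₖ (1 : Matrix ({x : Λ' // x.1 ∉ Λ} → Fin N) _ ℂ)) (splitConfig h _) (splitConfig h _)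
    at key
  simpa [Matrix.kroneckerMap_apply] using key

theorem norm_extend [NeZero N] {Λ Λ' : Finset L} (h : Λ ≤ Λ') (A : BoxAlgebra N Λ) :
    ‖extend h A‖ = ‖A‖ :=
  NonUnitalStarAlgHom.norm_map (extend h) (extend_injective h) A

/-- The algebra `𝒜₀ = ⋃_Λ 𝒜_Λ` of local observables: the direct limit of the algebras `𝒜_Λ` over
the finite sets `Λ`, with `A ∈ 𝒜_Λ` identified with `A ⊗ 1 ∈ 𝒜_Λ'` for `Λ ⊆ Λ'`. -/
def LocalAlgebra (L : Type u) [DecidableEq L] (N : ℕ) : Type u :=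
  DirectLimit (fun Λ : Finset L => BoxAlgebra N Λ) fun _ _ h => extend h

namespace LocalAlgebra

instance : Ring (LocalAlgebra L N) :=
  inferInstanceAs (Ring (DirectLimit (fun Λ : Finset L => BoxAlgebra N Λ) fun _ _ h => extend h))

instance : StarRing (LocalAlgebra L N) where
  star := (star : DirectLimit (fun Λ : Finset L => BoxAlgebra N Λ) (fun _ _ h => extend h) → _)
  star_involutive := star_involutive (R := DirectLimit (fun Λ : Finset L => BoxAlgebra N Λ) _)
  star_mul := star_mul (R := DirectLimit (fun Λ : Finset L => BoxAlgebra N Λ) _)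
  star_add := star_add (R := DirectLimit (fun Λ : Finset L => BoxAlgebra N Λ) _)

instance : Module ℂ (LocalAlgebra L N) :=
  inferInstanceAs (Module ℂ
    (DirectLimit (fun Λ : Finset L => BoxAlgebra N Λ) fun _ _ h => extend h))

/-- The canonical map `𝒜_Λ → 𝒜₀`. -/
def mk (Λ : Finset L) (A : BoxAlgebra N Λ) : LocalAlgebra L N :=
  (⟦⟨Λ, A⟩⟧ : DirectLimit (fun Λ : Finset L => BoxAlgebra N Λ) fun _ _ h => extend h)

theorem mk_extend {Λ Λ' : Finset L} (h : Λ ≤ Λ') (A : BoxAlgebra N Λ) :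
    mk Λ' (extend h A) = mk Λ A :=
  DirectLimit.mk_apply (f := fun _ _ h => extend h) Λ Λ' A h

theorem mk_add (Λ : Finset L) (A B : BoxAlgebra N Λ) : mk Λ (A + B) = mk Λ A + mk Λ B :=
  (DirectLimit.add_def (f := fun _ _ h => extend h) Λ A B).symm

theorem mk_mul (Λ : Finset L) (A B : BoxAlgebra N Λ) : mk Λ (A * B) = mk Λ A * mk Λ B :=
  (DirectLimit.mul_def (f := fun _ _ h => extend h) Λ A B).symm

theorem mk_zero (Λ : Finset L) : mk Λ (0 : BoxAlgebra N Λ) = 0 :=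
  (DirectLimit.zero_def (f := fun _ _ h => extend h) Λ).symm

theorem mk_one (Λ : Finset L) : mk Λ (1 : BoxAlgebra N Λ) = 1 :=
  (DirectLimit.one_def (f := fun _ _ h => extend h) Λ).symm

theorem mk_neg (Λ : Finset L) (A : BoxAlgebra N Λ) : mk Λ (-A) = -mk Λ A :=
  (DirectLimit.neg_def (f := fun _ _ h => extend h) Λ A).symm

theorem mk_star (Λ : Finset L) (A : BoxAlgebra N Λ) : mk Λ (star A) = star (mk Λ A) := rfl

theorem mk_smul (Λ : Finset L) (c : ℂ) (A : BoxAlgebra N Λ) : mk Λ (c • A) = c • mk Λ A := rfl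

theorem exists_mk₂ (a b : LocalAlgebra L N) : ∃ Λ A B, a = mk Λ A ∧ b = mk Λ B :=
  DirectLimit.exists_eq_mk₂ (fun _ _ h => extend h) a b

theorem exists_mk (a : LocalAlgebra L N) : ∃ Λ A, a = mk Λ A :=
  DirectLimit.exists_eq_mk (fun _ _ h => extend h) a

instance : Algebra ℂ (LocalAlgebra L N) :=
  Algebra.ofModule
    (fun c a b => by
      obtain ⟨Λ, A, B, rfl, rfl⟩ := exists_mk₂ a b
      rw [← mk_smul, ← mk_mul, ← mk_mul, ← mk_smul, smul_mul_assoc])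
    (fun c a b => by
      obtain ⟨Λ, A, B, rfl, rfl⟩ := exists_mk₂ a b
      rw [← mk_smul, ← mk_mul, ← mk_mul, ← mk_smul, mul_smul_comm])

instance : StarModule ℂ (LocalAlgebra L N) where
  star_smul c a := by
    obtain ⟨Λ, A, rfl⟩ := exists_mk a
    rw [← mk_smul, ← mk_star, ← mk_star, ← mk_smul, star_smul]

variable [NeZero N]

/-- The norm of `A ∈ 𝒜_Λ ⊆ 𝒜₀` is its operator norm. -/
instance : Norm (LocalAlgebra L N) where
  norm := DirectLimit.lift (fun _ _ h => extend h) (fun _ A => ‖A‖)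
    fun _ _ h A => (norm_extend h A).symm

theorem norm_mk (Λ : Finset L) (A : BoxAlgebra N Λ) : ‖mk Λ A‖ = ‖A‖ := rfl

instance : NormedAddCommGroup (LocalAlgebra L N) :=
  AddGroupNorm.toNormedAddCommGroup
    { toFun := norm
      map_zero' := by rw [← mk_zero ∅, norm_mk, norm_zero]
      add_le' := fun a b => by
        obtain ⟨Λ, A, B, rfl, rfl⟩ := exists_mk₂ a b
        simpa only [← mk_add, norm_mk] using norm_add_le A B
      neg' := fun a => by
        obtain ⟨Λ, A, rfl⟩ := exists_mk a
        simp only [← mk_neg, norm_mk, norm_neg]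
      eq_zero_of_map_eq_zero' := fun a h => by
        obtain ⟨Λ, A, rfl⟩ := exists_mk a
        rw [norm_mk, norm_eq_zero] at h
        rw [h, mk_zero] }

instance : NormedRing (LocalAlgebra L N) where
  __ : NormedAddCommGroup (LocalAlgebra L N) := inferInstance
  __ : Ring (LocalAlgebra L N) := inferInstance
  norm_mul_le a b := by
    obtain ⟨Λ, A, B, rfl, rfl⟩ := exists_mk₂ a b
    rw [← mk_mul]
    exact norm_mul_le A B

instance : NormedAlgebra ℂ (LocalAlgebra L N) where
  norm_smul_le c a := by
    obtain ⟨Λ, A, rfl⟩ := exists_mk a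
    rw [← mk_smul]
    exact norm_smul_le c A

instance : CStarRing (LocalAlgebra L N) where
  norm_mul_self_le a := by
    obtain ⟨Λ, A, rfl⟩ := exists_mk a
    rw [← mk_star, ← mk_mul]
    exact CStarRing.norm_mul_self_le A

end LocalAlgebra

section Completion

variable {A : Type u} [NormedRing A] [StarRing A]

theorem continuous_completion_star :
    Continuous (Completion.map (star : A → A)) :=
  Completion.continuous_map

variable [CStarRing A]

theorem completion_star_coe (a : A) :
    Completion.map (star : A → A) (a : Completion A) = ((star a : A) : Completion A) :=
  Completion.map_coe star_isometry.uniformContinuous a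

variable [NormedAlgebra ℂ A] [StarModule ℂ A]

/-- The completion of a pre-C⋆-algebra `A`; the product and the scalar multiplication are those of
the completion, and the adjoint is the continuous extension of the adjoint on `A`. -/
@[reducible] def completionCStarAlgebra : CStarAlgebra (Completion A) where
  __ : NormedRing (Completion A) := inferInstance
  __ : Algebra ℂ (Completion A) := Algebra.ofModule
    (fun c a b => by
      induction a, b using Completion.induction_on₂ with
      | hp =>
        exact isClosed_eq ((continuous_fst.const_smul c).mul continuous_snd)
          ((continuous_fst.mul continuous_snd).const_smul c)
      | ih a b =>
        rw [← Completion.coe_smul, ← Completion.coe_mul, ← Completion.coe_mul,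
          ← Completion.coe_smul, smul_mul_assoc])
    (fun c a b => by
      induction a, b using Completion.induction_on₂ with
      | hp =>
        exact isClosed_eq (continuous_fst.mul (continuous_snd.const_smul c))
          ((continuous_fst.mul continuous_snd).const_smul c)
      | ih a b =>
        rw [← Completion.coe_smul, ← Completion.coe_mul, ← Completion.coe_mul,
          ← Completion.coe_smul, mul_smul_comm])
  toCompleteSpace := inferInstance
  star := Completion.map (star : A → A)
  star_involutive a := by
    induction a using Completion.induction_on with
    | hp =>
      exact isClosed_eq (continuous_completion_star.comp continuous_completion_star) continuous_id
    | ih a => rw [completion_star_coe, completion_star_coe, star_star]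
  star_mul a b := by
    change Completion.map star (a * b) = Completion.map star b * Completion.map star a
    induction a, b using Completion.induction_on₂ with
    | hp =>
      exact isClosed_eq (continuous_completion_star.comp (continuous_fst.mul continuous_snd))
        ((continuous_completion_star.comp continuous_snd).mul
          (continuous_completion_star.comp continuous_fst))
    | ih a b =>
      rw [← Completion.coe_mul, completion_star_coe, completion_star_coe, completion_star_coe,
        ← Completion.coe_mul, star_mul]
  star_add a b := by
    change Completion.map star (a + b) = Completion.map star a + Completion.map star b
    induction a, b using Completion.induction_on₂ with
    | hp =>
      exact isClosed_eq (continuous_completion_star.comp (continuous_fst.add continuous_snd))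
        ((continuous_completion_star.comp continuous_fst).add
          (continuous_completion_star.comp continuous_snd))
    | ih a b =>
      rw [← Completion.coe_add, completion_star_coe, completion_star_coe, completion_star_coe,
        ← Completion.coe_add, star_add]
  norm_smul_le := norm_smul_le
  norm_mul_self_le a := by
    change ‖a‖ * ‖a‖ ≤ ‖Completion.map star a * a‖
    induction a using Completion.induction_on with
    | hp =>
      exact isClosed_le (continuous_norm.mul continuous_norm)
        (continuous_completion_star.mul continuous_id).norm
    | ih a =>
      rw [completion_star_coe, ← Completion.coe_mul, Completion.norm_coe, Completion.norm_coe]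
      exact CStarRing.norm_mul_self_le a
  star_smul c a := by
    change Completion.map star (c • a) = star c • Completion.map star a
    induction a using Completion.induction_on with
    | hp =>
      exact isClosed_eq (continuous_completion_star.comp (continuous_id.const_smul c))
        (continuous_completion_star.const_smul (star c))
    | ih a =>
      rw [← Completion.coe_smul, completion_star_coe, completion_star_coe, ← Completion.coe_smul,
        star_smul]

end Completion

/-- The C⋆-algebra `𝒜` of quasi-local observables: the norm completion of `𝒜₀`. -/
def QuasiLocalAlgebra (L : Type u) [DecidableEq L] (N : ℕ) [NeZero N] : Type u :=
  Completion (LocalAlgebra L N)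

namespace QuasiLocalAlgebra

variable [NeZero N]

instance : CStarAlgebra (QuasiLocalAlgebra L N) :=
  completionCStarAlgebra (A := LocalAlgebra L N)

/-- The inclusion `𝒜₀ → 𝒜`. -/
def ofLocal (a : LocalAlgebra L N) : QuasiLocalAlgebra L N :=
  (a : Completion (LocalAlgebra L N))

theorem denseRange_ofLocal :
    DenseRange (ofLocal : LocalAlgebra L N → QuasiLocalAlgebra L N) :=
  Completion.denseRange_coe (α := LocalAlgebra L N)

theorem ofLocal_mul (a b : LocalAlgebra L N) : ofLocal (a * b) = ofLocal a * ofLocal b :=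
  Completion.coe_mul a b

theorem ofLocal_add (a b : LocalAlgebra L N) : ofLocal (a + b) = ofLocal a + ofLocal b :=
  Completion.coe_add a b

theorem ofLocal_one : ofLocal (1 : LocalAlgebra L N) = 1 := rfl

theorem ofLocal_zero : ofLocal (0 : LocalAlgebra L N) = 0 := rfl

theorem ofLocal_smul (c : ℂ) (a : LocalAlgebra L N) : ofLocal (c • a) = c • ofLocal a :=
  Completion.coe_smul c a

theorem ofLocal_star (a : LocalAlgebra L N) : ofLocal (star a) = star (ofLocal a) :=
  (completion_star_coe a).symm

theorem norm_ofLocal (a : LocalAlgebra L N) : ‖ofLocal a‖ = ‖a‖ :=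
  Completion.norm_coe a

end QuasiLocalAlgebra

section Dynamics

variable [NeZero N]

/-- The inclusion `𝒜_Λ → 𝒜`. -/
def incl (Λ : Finset L) : BoxAlgebra N Λ →⋆ₐ[ℂ] QuasiLocalAlgebra L N where
  toFun A := QuasiLocalAlgebra.ofLocal (LocalAlgebra.mk Λ A)
  map_one' := by rw [LocalAlgebra.mk_one, QuasiLocalAlgebra.ofLocal_one]
  map_mul' A B := by rw [LocalAlgebra.mk_mul, QuasiLocalAlgebra.ofLocal_mul]
  map_zero' := by rw [LocalAlgebra.mk_zero, QuasiLocalAlgebra.ofLocal_zero]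
  map_add' A B := by rw [LocalAlgebra.mk_add, QuasiLocalAlgebra.ofLocal_add]
  commutes' c := by
    rw [Algebra.algebraMap_eq_smul_one, LocalAlgebra.mk_smul, LocalAlgebra.mk_one,
      QuasiLocalAlgebra.ofLocal_smul, QuasiLocalAlgebra.ofLocal_one,
      Algebra.algebraMap_eq_smul_one]
  map_star' A := by rw [LocalAlgebra.mk_star, QuasiLocalAlgebra.ofLocal_star]

theorem norm_incl (Λ : Finset L) (A : BoxAlgebra N Λ) : ‖incl Λ A‖ = ‖A‖ :=
  QuasiLocalAlgebra.norm_ofLocal (LocalAlgebra.mk Λ A)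

theorem incl_extend {Λ Λ' : Finset L} (h : Λ ≤ Λ') (A : BoxAlgebra N Λ) :
    incl Λ' (extend h A) = incl Λ A :=
  congrArg QuasiLocalAlgebra.ofLocal (LocalAlgebra.mk_extend h A)

/-- The set of local observables, as elements of `𝒜`. -/
def localObservables (L : Type u) [DecidableEq L] (N : ℕ) [NeZero N] :
    Set (QuasiLocalAlgebra L N) :=
  Set.range QuasiLocalAlgebra.ofLocal

/-- An interaction: a hermitian operator `Φ_X ∈ 𝒜_X` for every finite set `X` of sites. -/
structure Interaction (L : Type u) [DecidableEq L] (N : ℕ) where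
  /-- the operator `Φ_X` -/
  op : (X : Finset L) → BoxAlgebra N X
  isHermitian : ∀ X, (op X).IsHermitian

/-- `‖Φ‖_r = sup_x ∑_{X ∋ x} ‖Φ_X‖ r^|X|`, possibly infinite. -/
def Interaction.norm (Φ : Interaction L N) (r : ℝ≥0) : ℝ≥0∞ :=
  ⨆ x : L, ∑' X : {X : Finset L // x ∈ X}, ‖Φ.op X.1‖ₑ * (r : ℝ≥0∞) ^ X.1.card

/-- The Hamiltonian `H_Λ = ∑_{X ⊆ Λ} Φ_X`. -/
def Interaction.hamiltonian (Φ : Interaction L N) (Λ : Finset L) : QuasiLocalAlgebra L N :=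
  ∑ X ∈ Λ.powerset, incl X (Φ.op X)

/-- The finite-volume time evolution `α_t^Λ(A) = e^{itH_Λ} A e^{-itH_Λ}`. -/
def Interaction.boxEvolution (Φ : Interaction L N) (Λ : Finset L) (t : ℂ)
    (A : QuasiLocalAlgebra L N) : QuasiLocalAlgebra L N :=
  NormedSpace.exp ((Complex.I * t) • Φ.hamiltonian Λ) * A *
    NormedSpace.exp (-((Complex.I * t) • Φ.hamiltonian Λ))

/-- `α` is the infinite-volume time evolution of `Φ`: a one-parameter group of `⋆`-automorphisms
of `𝒜` such that `α_t^{Λ_n}(A) → α_t(A)` in norm for all `t`, every local `A` and every sequence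
`Λ_n` of finite sets that eventually contain any given finite set. -/
structure Interaction.IsTimeEvolution (Φ : Interaction L N)
    (α : ℝ → (QuasiLocalAlgebra L N ≃⋆ₐ[ℂ] QuasiLocalAlgebra L N)) : Prop where
  map_zero : ∀ A, α 0 A = A
  map_add : ∀ s t A, α (s + t) A = α s (α t A)
  tendsto : ∀ Λ : ℕ → Finset L, Tendsto Λ atTop atTop →
    ∀ t : ℝ, ∀ A ∈ localObservables L N,
      Tendsto (fun n => Φ.boxEvolution (Λ n) t A) atTop (𝓝 (α t A))

/-- A state: a bounded, positive, normalized linear functional on `𝒜`. -/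
structure IsState (ρ : QuasiLocalAlgebra L N →L[ℂ] ℂ) : Prop where
  nonneg : ∀ A, 0 ≤ ρ (star A * A)
  map_one : ρ 1 = 1

/-- `W = α_{iβ}(A)`: the function `t ↦ α_t(A)` on `ℝ` has an analytic continuation `f` to a
neighbourhood of the strip `0 ≤ Im z ≤ β`, and `f(iβ) = W`. (By the identity theorem there is at
most one such `W`.) -/
def IsEvolutionAtImaginaryTime (α : ℝ → (QuasiLocalAlgebra L N ≃⋆ₐ[ℂ] QuasiLocalAlgebra L N))
    (β : ℝ) (A W : QuasiLocalAlgebra L N) : Prop :=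
  ∃ f : ℂ → QuasiLocalAlgebra L N,
    AnalyticOnNhd ℂ f {z : ℂ | 0 ≤ z.im ∧ z.im ≤ β} ∧
      (∀ t : ℝ, f t = α t A) ∧ f (Complex.I * β) = W

/-- `ρ` is a KMS state at inverse temperature `β`: a state such that `α_{iβ}(A)` is defined and
`ρ(A B) = ρ(B α_{iβ}(A))` for all local `A`, `B`. -/
structure IsKMSState (α : ℝ → (QuasiLocalAlgebra L N ≃⋆ₐ[ℂ] QuasiLocalAlgebra L N))
    (β : ℝ) (ρ : QuasiLocalAlgebra L N →L[ℂ] ℂ) : Prop where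
  isState : IsState ρ
  kms : ∀ A ∈ localObservables L N, ∃ W, IsEvolutionAtImaginaryTime α β A W ∧
    ∀ B ∈ localObservables L N, ρ (A * B) = ρ (B * W)

end Dynamics

end QuantumLattice

end

/-! Everything rests on one majorant estimate, `sum_adCLM_pow_le`. Let δ = [H_Λ, ·], and let p be a
seminorm for which multiplication by Φ_X on either side costs a factor c_X, where 2 ∑_{X ∋ x} c_X
r^|X| ≤ κ for all x. Only the sets X that meet Y contribute to δ(a) for a local in Y, and comparison
with the derivative of (1 + κt)^|Y| gives ∑ t^n/n! p(δ^n a) ≤ (1 + κt)^|Y| p(a) as long as 1 + κt ≤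
r, uniformly in Λ.

Dynamics and existence: take p to be the norm and c_X = ‖Φ_X‖. The evolution of a local element
converges in the disc |z| < (r - 1)/κ. Real-time evolutions are isometric and form a group, so
convergence extends to all real times, and for local elements to the strip |Im z| < (r - 1)/κ, which
contains iβ. Gibbs states built on the tracial state satisfy the finite-volume KMS identity, and a
limit along an ultrafilter is a KMS state (`exists_isKMSState`).

Uniqueness (`eq_zero_of_twisted_trace`): let D be the difference of two KMS states and p(b) = sup
|D(u b v)| over Weyl operators u, v. A matrix on X has Weyl coefficients of ℓ¹-norm at most N^|X|
times its norm, so c_X = ‖Φ_X‖ N^|X| is admissible for p. If e is a nonscalar Weyl operator, the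
average of u e u⁻¹ over the Weyl operators u of a suitable single site vanishes, while the KMS
identity gives D(e) - D(u e u⁻¹) = -D(e u⁻¹ (α_{iβ}(u) - u)). As u lives on one site, the majorant
bounds this by κβ p(1). Since D(1) = 0, taking the supremum over e gives p(1) ≤ κβ p(1) with κβ < 1,
so D vanishes on the Weyl operators, which span the local observables. -/

noncomputable section

namespace QuantumLattice

open scoped Kronecker Matrix.Norms.L2Operator ComplexOrder
open UniformSpace Filter Topology

universe u

/-! ### The majorant estimate for iterated commutators. -/

section AbstractNet

variable {L : Type*} [DecidableEq L] {𝔄 : Type*} [NormedRing 𝔄] [NormedAlgebra ℂ 𝔄]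

/-- The commutator with `H`, as a bounded operator. -/
def adCLM (H : 𝔄) : 𝔄 →L[ℂ] 𝔄 :=
  ContinuousLinearMap.mul ℂ 𝔄 H - (ContinuousLinearMap.mul ℂ 𝔄).flip H

@[simp] theorem adCLM_apply (H a : 𝔄) : adCLM H a = H * a - a * H := rfl

/-- An interaction with values in a normed algebra, together with the local algebras: the terms
`h X` are local in `X`, and disjoint local algebras commute. -/
structure IsLocalInteraction (loc : Finset L → Subalgebra ℂ 𝔄) (h : Finset L → 𝔄) : Prop where
  mono : ∀ {X Y}, X ⊆ Y → loc X ≤ loc Y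
  commute : ∀ {X Y}, Disjoint X Y → ∀ a ∈ loc X, ∀ b ∈ loc Y, Commute a b
  mem : ∀ X, h X ∈ loc X

/-- The sums `2 ∑_{X ∋ x} c X * r ^ |X|` are bounded by `κ`. -/
def WeightBound (c : Finset L → ℝ) (r κ : ℝ) : Prop :=
  ∀ x : L, ∀ S : Finset (Finset L), (∀ X ∈ S, x ∈ X) → ∑ X ∈ S, 2 * (c X * r ^ X.card) ≤ κ

/-- The Hamiltonian of a family of terms. -/
def boxSum (h : Finset L → 𝔄) (Λ : Finset L) : 𝔄 := ∑ X ∈ Λ.powerset, h X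

variable {loc : Finset L → Subalgebra ℂ 𝔄} {h : Finset L → 𝔄}

/-- Terms supported away from `Y` commute with `a`. -/
theorem adCLM_boxSum_apply (hloc : IsLocalInteraction loc h) (Λ : Finset L) {Y : Finset L} {a : 𝔄}
    (ha : a ∈ loc Y) :
    adCLM (boxSum h Λ) a = ∑ X ∈ Λ.powerset with ¬ Disjoint X Y, adCLM (h X) a := by
  rw [Finset.sum_filter_of_ne]
  · simp only [adCLM_apply, boxSum, Finset.sum_mul, Finset.mul_sum, Finset.sum_sub_distrib]
  · intro X _ hX hd
    exact hX (sub_eq_zero.2 (hloc.commute hd _ (hloc.mem X) _ ha).eq)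

theorem IsLocalInteraction.adCLM_mem (hloc : IsLocalInteraction loc h) {X Y : Finset L} {a : 𝔄}
    (ha : a ∈ loc Y) : adCLM (h X) a ∈ loc (Y ∪ X) := by
  have h1 := hloc.mono (Finset.subset_union_right (s₁ := Y)) (hloc.mem X)
  have h2 := hloc.mono (Finset.subset_union_left (s₂ := X)) ha
  exact sub_mem (mul_mem h1 h2) (mul_mem h2 h1)

/-- Summing over the sets that meet `Y` costs at most a factor `|Y|`. -/
theorem WeightBound.sum_le {c : Finset L → ℝ} (hc : ∀ X, 0 ≤ c X) {r κ u : ℝ}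
    (hκ : WeightBound c r κ) (hu : 0 ≤ u) (hur : u ≤ r) (S : Finset (Finset L)) (Y : Finset L)
    (hS : ∀ X ∈ S, ¬ Disjoint X Y) :
    ∑ X ∈ S, 2 * (c X * u ^ X.card) ≤ Y.card * κ := by
  have hnn : ∀ X, 0 ≤ 2 * (c X * u ^ X.card) := fun X => by have := hc X; positivity
  calc ∑ X ∈ S, 2 * (c X * u ^ X.card)
      ≤ ∑ X ∈ S, ∑ x ∈ Y, if x ∈ X then 2 * (c X * u ^ X.card) else 0 := by
        refine Finset.sum_le_sum fun X hX => ?_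
        obtain ⟨x, hxX, hxY⟩ := Finset.not_disjoint_iff.1 (hS X hX)
        refine le_trans (by rw [if_pos hxX])
          (Finset.single_le_sum (f := fun x => if x ∈ X then 2 * (c X * u ^ X.card) else 0)
            (fun y _ => ?_) hxY)
        split_ifs
        exacts [hnn X, le_rfl]
    _ = ∑ x ∈ Y, ∑ X ∈ S with x ∈ X, 2 * (c X * u ^ X.card) := by
        rw [Finset.sum_comm]
        simp only [Finset.sum_filter]
    _ ≤ ∑ x ∈ Y, κ := by
        refine Finset.sum_le_sum fun x _ => le_trans (Finset.sum_le_sum fun X _ => ?_)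
          (hκ x (S.filter (x ∈ ·)) fun X hX => (Finset.mem_filter.1 hX).2)
        have := hc X
        gcongr
    _ = Y.card * κ := by simp

theorem Seminorm.adCLM_le {𝔄 : Type*} [NormedRing 𝔄] [NormedAlgebra ℂ 𝔄] (p : Seminorm ℂ 𝔄)
    {H : 𝔄} {c : ℝ} (hl : ∀ b, p (H * b) ≤ c * p b) (hr : ∀ b, p (b * H) ≤ c * p b) (b : 𝔄) :
    p (adCLM H b) ≤ 2 * c * p b := by
  have h1 := map_sub_le_add p (H * b) (b * H)
  have h2 := hl b
  have h3 := hr b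
  rw [adCLM_apply]
  linarith

/-- The partial sums of the exponential series of the derivation are dominated, on an element local
in `Y`, by the solution `(1 + κ t) ^ |Y|` of the majorant equation. -/
theorem sum_adCLM_pow_le (hloc : IsLocalInteraction loc h) (p : Seminorm ℂ 𝔄) {c : Finset L → ℝ}
    (hc : ∀ X, 0 ≤ c X) (hl : ∀ X b, p (h X * b) ≤ c X * p b)
    (hr : ∀ X b, p (b * h X) ≤ c X * p b) {r κ : ℝ} (hκ0 : 0 ≤ κ) (hκ : WeightBound c r κ)
    (Λ : Finset L) (M : ℕ) : ∀ (Y : Finset L) (a : 𝔄), a ∈ loc Y → ∀ t : ℝ, 0 ≤ t → 1 + κ * t ≤ r →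
      ∑ n ∈ Finset.range M, t ^ n / n.factorial * p ((adCLM (boxSum h Λ) ^ n) a) ≤
        (1 + κ * t) ^ Y.card * p a := by
  set δ := adCLM (boxSum h Λ) with hδ
  induction M with
  | zero =>
    intro Y a _ t ht _
    have := apply_nonneg p a
    simp only [Finset.range_zero, Finset.sum_empty]
    positivity
  | succ M ih =>
    intro Y a ha T hT hTr
    -- This compares t-derivatives: on the left that of the partial sum with one more term, on the
    -- right that of the majorant `(1 + κ t) ^ |Y| * p a`.
    have key : ∀ t : ℝ, 0 ≤ t → 1 + κ * t ≤ r →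
        ∑ n ∈ Finset.range M, t ^ n / n.factorial * p ((δ ^ (n + 1)) a) ≤
          Y.card * (1 + κ * t) ^ (Y.card - 1) * κ * p a := by
      intro t ht htr
      set S := Λ.powerset.filter fun X => ¬ Disjoint X Y with hS
      have hu : 1 ≤ 1 + κ * t := by nlinarith [mul_nonneg hκ0 ht]
      calc ∑ n ∈ Finset.range M, t ^ n / n.factorial * p ((δ ^ (n + 1)) a)
          ≤ ∑ n ∈ Finset.range M, ∑ X ∈ S,
              t ^ n / n.factorial * p ((δ ^ n) (adCLM (h X) a)) := by
            refine Finset.sum_le_sum fun n _ => ?_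
            rw [← Finset.mul_sum, pow_succ, mul_apply_eq_comp, hδ,
              adCLM_boxSum_apply hloc Λ ha, map_sum]
            exact mul_le_mul_of_nonneg_left (Finset.le_sum_of_subadditive p (map_zero p).le
              (map_add_le_add p) _ _) (by positivity)
        _ = ∑ X ∈ S, ∑ n ∈ Finset.range M,
              t ^ n / n.factorial * p ((δ ^ n) (adCLM (h X) a)) := Finset.sum_comm
        _ ≤ ∑ X ∈ S, (1 + κ * t) ^ (Y.card - 1) * p a * (2 * (c X * (1 + κ * t) ^ X.card)) := by
            refine Finset.sum_le_sum fun X hX => ?_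
            refine (ih _ _ (hloc.adCLM_mem ha) t ht htr).trans ?_
            have hd := (Finset.mem_filter.1 hX).2
            -- The common site of `X` and `Y` saves one power, which yields exactly the exponent in
            -- the derivative of the majorant.
            have hcard : (Y ∪ X).card ≤ (Y.card - 1) + X.card := by
              have h1 := Finset.card_union_add_card_inter Y X
              have h2 : 0 < (Y ∩ X).card := by
                rw [Finset.card_pos, Finset.inter_comm]
                exact Finset.not_disjoint_iff_nonempty_inter.1 hd
              have h3 := Finset.card_le_card (Finset.inter_subset_left (s₁ := Y) (s₂ := X))
              omega
            calc (1 + κ * t) ^ (Y ∪ X).card * p (adCLM (h X) a)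
                ≤ (1 + κ * t) ^ ((Y.card - 1) + X.card) * (2 * c X * p a) := by
                  have := apply_nonneg p (adCLM (h X) a)
                  gcongr
                  · exact Seminorm.adCLM_le p (hl X) (hr X) a
              _ = _ := by rw [pow_add]; ring
        _ = (1 + κ * t) ^ (Y.card - 1) * p a * ∑ X ∈ S, 2 * (c X * (1 + κ * t) ^ X.card) := by
            rw [Finset.mul_sum]
        _ ≤ (1 + κ * t) ^ (Y.card - 1) * p a * (Y.card * κ) := by
            have := apply_nonneg p a
            refine mul_le_mul_of_nonneg_left ?_ (by positivity)
            exact hκ.sum_le hc (by linarith) htr S Y fun X hX => (Finset.mem_filter.1 hX).2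
        _ = _ := by ring
    -- `F` is majorant minus partial sum: it vanishes at `0`, where only the term n = 0 survives,
    -- and `key` makes its derivative nonnegative.
    let F : ℝ → ℝ := fun t => (1 + κ * t) ^ Y.card * p a -
      ∑ n ∈ Finset.range (M + 1), t ^ n / n.factorial * p ((δ ^ n) a)
    have hF : ∀ t, HasDerivAt F (Y.card * (1 + κ * t) ^ (Y.card - 1) * κ * p a -
        ∑ n ∈ Finset.range M, t ^ n / n.factorial * p ((δ ^ (n + 1)) a)) t := by
      intro t
      refine HasDerivAt.sub ?_ ?_
      · have := (((hasDerivAt_id t).const_mul κ).const_add 1).pow Y.card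
        simpa using this.mul_const (p a)
      · have h1 : ∀ n ∈ Finset.range (M + 1), HasDerivAt
            (fun t : ℝ => t ^ n / n.factorial * p ((δ ^ n) a))
            (n * t ^ (n - 1) / n.factorial * p ((δ ^ n) a)) t := fun n _ =>
          ((hasDerivAt_pow n t).div_const _).mul_const _
        have h2 := HasDerivAt.fun_sum h1
        rw [Finset.sum_range_succ'] at h2
        convert h2 using 1
        simp only [Nat.cast_zero, zero_mul, zero_div, add_zero, Nat.add_sub_cancel]
        refine Finset.sum_congr rfl fun n _ => ?_
        rw [Nat.factorial_succ]
        push_cast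
        have : (n.factorial : ℝ) ≠ 0 := by positivity
        have : (n : ℝ) + 1 ≠ 0 := by positivity
        field_simp
    have hmono : MonotoneOn F (Set.Icc 0 T) := by
      refine monotoneOn_of_deriv_nonneg (convex_Icc _ _)
        (fun t _ => (hF t).continuousAt.continuousWithinAt)
        (fun t _ => (hF t).differentiableAt.differentiableWithinAt) fun t ht => ?_
      rw [interior_Icc] at ht
      rw [(hF t).deriv]
      exact sub_nonneg.2 (key t ht.1.le (by nlinarith [ht.2]))
    have h0 : F 0 = 0 := by
      simp [F, Finset.sum_range_succ']
    have := hmono (Set.left_mem_Icc.2 hT) (Set.right_mem_Icc.2 hT) hT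
    rw [h0] at this
    exact sub_nonneg.1 this

end AbstractNet

/-! ### Evolution at complex time as the exponential of a derivation. -/

section Evolution

variable {𝔄 : Type*} [CStarAlgebra 𝔄]

/-- The evolution `e^{izH} a e^{-izH}` at complex time `z`. -/
def evolution (H : 𝔄) (z : ℂ) (a : 𝔄) : 𝔄 :=
  NormedSpace.exp ((Complex.I * z) • H) * a * NormedSpace.exp (-((Complex.I * z) • H))

theorem hasSum_exp_smul_clm {E : Type*} [NormedAddCommGroup E] [NormedSpace ℂ E] [CompleteSpace E]
    (T : E →L[ℂ] E) (c : ℂ) (a : E) :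
    HasSum (fun n : ℕ => (c ^ n / n.factorial) • (T ^ n) a) (NormedSpace.exp (c • T) a) := by
  have h1 := NormedSpace.exp_series_hasSum_exp' (𝕂 := ℂ) (c • T)
  have h2 := h1.mapL (ContinuousLinearMap.apply ℂ E a)
  refine h2.congr_fun fun n => ?_
  rw [smul_pow, smul_smul, div_eq_inv_mul]
  rfl

/-- The derivation is left minus right multiplication by `H`. These two commute, so the exponential
factors, and the exponential of a multiplication operator is multiplication by the exponential. -/
theorem exp_smul_adCLM_apply (H : 𝔄) (c : ℂ) (a : 𝔄) :
    NormedSpace.exp (c • adCLM H) a =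
      NormedSpace.exp (c • H) * a * NormedSpace.exp (-(c • H)) := by
  let l : 𝔄 →L[ℂ] 𝔄 := ContinuousLinearMap.mul ℂ 𝔄 H
  let r : 𝔄 →L[ℂ] 𝔄 := (ContinuousLinearMap.mul ℂ 𝔄).flip H
  have hl : ∀ n b, (l ^ n) b = H ^ n * b := by
    intro n
    induction n with
    | zero => simp
    | succ n ih => intro b; rw [pow_succ, mul_apply_eq_comp, ih, pow_succ, mul_assoc]; rfl
  have hr : ∀ n b, (r ^ n) b = b * H ^ n := by
    intro n
    induction n with
    | zero => simp
    | succ n ih => intro b; rw [pow_succ, mul_apply_eq_comp, ih, pow_succ', ← mul_assoc]; rfl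
  have hexp : ∀ c : ℂ, HasSum (fun n : ℕ => (c ^ n / n.factorial) • H ^ n)
      (NormedSpace.exp (c • H)) := fun c => by
    refine (NormedSpace.exp_series_hasSum_exp' (𝕂 := ℂ) (c • H)).congr_fun fun n => ?_
    simp [smul_pow, smul_smul, div_eq_inv_mul]
  have el : ∀ (c : ℂ) b, NormedSpace.exp (c • l) b = NormedSpace.exp (c • H) * b := fun c b => by
    refine (hasSum_exp_smul_clm l c b).unique ?_
    simpa [hl] using (hexp c).mul_right b
  have er : ∀ (c : ℂ) b, NormedSpace.exp (c • r) b = b * NormedSpace.exp (c • H) := fun c b => by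
    refine (hasSum_exp_smul_clm r c b).unique ?_
    simpa [hr] using (hexp c).mul_left b
  have hcomm : Commute (c • l) ((-c) • r) := by
    refine ContinuousLinearMap.ext fun b => ?_
    change c • (H * ((-c) • (b * H))) = (-c) • ((c • (H * b)) * H)
    simp only [mul_smul_comm, smul_mul_assoc, smul_smul, mul_assoc, mul_comm c]
  have hsub : c • adCLM H = c • l + (-c) • r := by
    refine ContinuousLinearMap.ext fun b => ?_
    change c • (H * b - b * H) = c • (H * b) + (-c) • (b * H)
    rw [smul_sub, neg_smul, sub_eq_add_neg]
  let _ : NormedAlgebra ℚ (𝔄 →L[ℂ] 𝔄) := NormedAlgebra.restrictScalars ℚ ℂ _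
  rw [hsub, NormedSpace.exp_add_of_commute hcomm, mul_apply_eq_comp, er, el, neg_smul, mul_assoc]

theorem hasSum_evolution (H : 𝔄) (z : ℂ) (a : 𝔄) :
    HasSum (fun n : ℕ => ((Complex.I * z) ^ n / n.factorial) • (adCLM H ^ n) a)
      (evolution H z a) := by
  rw [evolution, ← exp_smul_adCLM_apply]
  exact hasSum_exp_smul_clm _ _ _

theorem evolution_zero (H a : 𝔄) : evolution H 0 a = a := by
  simp [evolution]

theorem exp_add_smul (H : 𝔄) (z w : ℂ) :
    NormedSpace.exp ((z + w) • H) = NormedSpace.exp (z • H) * NormedSpace.exp (w • H) := by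
  let _ : NormedAlgebra ℚ 𝔄 := NormedAlgebra.restrictScalars ℚ ℂ _
  rw [add_smul, NormedSpace.exp_add_of_commute]
  exact ((Commute.refl H).smul_left z).smul_right w

theorem exp_neg_smul_mul (H : 𝔄) (z : ℂ) :
    NormedSpace.exp (-(z • H)) * NormedSpace.exp (z • H) = 1 := by
  rw [← neg_smul, ← exp_add_smul, neg_add_cancel, zero_smul, NormedSpace.exp_zero]

theorem exp_smul_mul_neg (H : 𝔄) (z : ℂ) :
    NormedSpace.exp (z • H) * NormedSpace.exp (-(z • H)) = 1 := by
  rw [← neg_smul, ← exp_add_smul, add_neg_cancel, zero_smul, NormedSpace.exp_zero]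

theorem evolution_add (H : 𝔄) (z w : ℂ) (a : 𝔄) :
    evolution H (z + w) a = evolution H z (evolution H w a) := by
  have h1 : -((Complex.I * (z + w)) • H) = (-(Complex.I * w) + -(Complex.I * z)) • H := by
    rw [← neg_smul]; congr 1; ring
  rw [evolution, h1, mul_add Complex.I z w, exp_add_smul, exp_add_smul]
  simp only [evolution, neg_smul, mul_assoc]

theorem evolution_map_mul (H : 𝔄) (z : ℂ) (a b : 𝔄) :
    evolution H z (a * b) = evolution H z a * evolution H z b := by
  unfold evolution
  calc _ = NormedSpace.exp ((Complex.I * z) • H) * a * 1 * b *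
        NormedSpace.exp (-((Complex.I * z) • H)) := by simp only [mul_assoc, one_mul]
    _ = _ := by rw [← exp_neg_smul_mul H (Complex.I * z)]; simp only [mul_assoc]

theorem evolution_map_add (H : 𝔄) (z : ℂ) (a b : 𝔄) :
    evolution H z (a + b) = evolution H z a + evolution H z b := by
  simp only [evolution, mul_add, add_mul]

theorem evolution_map_sub (H : 𝔄) (z : ℂ) (a b : 𝔄) :
    evolution H z (a - b) = evolution H z a - evolution H z b := by
  simp only [evolution, mul_sub, sub_mul]

theorem evolution_map_smul (H : 𝔄) (z c : ℂ) (a : 𝔄) :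
    evolution H z (c • a) = c • evolution H z a := by
  simp only [evolution, mul_smul_comm, smul_mul_assoc]

theorem star_exp_smul {H : 𝔄} (hH : IsSelfAdjoint H) (t : ℝ) :
    star (NormedSpace.exp ((Complex.I * t) • H)) = NormedSpace.exp (-((Complex.I * t) • H)) := by
  rw [NormedSpace.star_exp, star_smul, hH.star_eq, ← neg_smul]
  simp

theorem evolution_map_star {H : 𝔄} (hH : IsSelfAdjoint H) (t : ℝ) (a : 𝔄) :
    evolution H t (star a) = star (evolution H t a) := by
  have h1 := star_exp_smul hH t
  have h2 := congrArg star h1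
  rw [star_star] at h2
  simp only [evolution, star_mul, h1, ← h2, mul_assoc]

theorem norm_evolution {H : 𝔄} (hH : IsSelfAdjoint H) (t : ℝ) (a : 𝔄) :
    ‖evolution H t a‖ = ‖a‖ := by
  have hu : NormedSpace.exp ((Complex.I * t) • H) ∈ unitary 𝔄 := by
    rw [Unitary.mem_iff, star_exp_smul hH]
    exact ⟨exp_neg_smul_mul _ _, exp_smul_mul_neg _ _⟩
  rw [evolution, ← star_exp_smul hH, CStarRing.norm_mul_mem_unitary _ (Unitary.star_mem hu),
    CStarRing.norm_mem_unitary_mul _ hu]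

end Evolution

/-! ### Infinite-volume limit in a disc of complex times. -/

section Limit

variable {L : Type*} [DecidableEq L] {𝔄 : Type*} [CStarAlgebra 𝔄]
  {loc : Finset L → Subalgebra ℂ 𝔄} {h : Finset L → 𝔄} {r κ : ℝ}

/-- A single term of the majorant estimate, at the largest admissible time R = (r - 1)/κ, where 1 +
κR = r. It is uniform in `Λ`, so R bounds the radius of convergence from below. -/
theorem norm_adCLM_pow_le (hloc : IsLocalInteraction loc h) (hκ0 : 0 < κ) (hr : 1 < r)
    (hκ : WeightBound (fun X => ‖h X‖) r κ) (Λ : Finset L) (n : ℕ) {Y : Finset L} {a : 𝔄}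
    (ha : a ∈ loc Y) :
    ‖(adCLM (boxSum h Λ) ^ n) a‖ ≤ n.factorial / ((r - 1) / κ) ^ n * (r ^ Y.card * ‖a‖) := by
  have hR : 0 < (r - 1) / κ := div_pos (by linarith) hκ0
  have h1 : 1 + κ * ((r - 1) / κ) = r := by field_simp; ring
  have key := sum_adCLM_pow_le hloc (normSeminorm ℂ 𝔄) (fun X => norm_nonneg (h X))
    (fun X b => norm_mul_le (h X) b) (fun X b => (norm_mul_le b (h X)).trans_eq (mul_comm _ _)) hκ0.le hκ Λ
    (n + 1) Y a ha _ hR.le h1.le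
  simp only [coe_normSeminorm, h1] at key
  have h2 := (Finset.single_le_sum (f := fun m : ℕ => ((r - 1) / κ) ^ m / m.factorial *
    ‖(adCLM (boxSum h Λ) ^ m) a‖) (fun m _ => by positivity) (Finset.self_mem_range_succ n)).trans
    key
  rw [div_mul_eq_mul_div, div_le_iff₀ (by positivity)] at h2
  rw [div_mul_eq_mul_div, le_div_iff₀ (by positivity)]
  linarith

theorem WeightBound.summable {c : Finset L → ℝ} (hc : ∀ X, 0 ≤ c X) (hr : 0 ≤ r)
    (hκ : WeightBound c r κ) (Y : Finset L) :
    Summable fun X : Finset L => if Disjoint X Y then 0 else 2 * (c X * r ^ X.card) := by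
  have hnn : ∀ X, 0 ≤ 2 * (c X * r ^ X.card) := fun X => by have := hc X; positivity
  refine summable_of_sum_le (c := Y.card * κ) (fun X => ?_) fun S => ?_
  · split_ifs
    exacts [le_rfl, hnn X]
  · have := hκ.sum_le hc hr le_rfl (S.filter fun X => ¬ Disjoint X Y) Y
      fun X hX => (Finset.mem_filter.1 hX).2
    rw [Finset.sum_filter] at this
    simpa only [ite_not] using this

/-- The iterated derivations of a local element converge in the infinite-volume limit. -/
theorem exists_tendsto_adCLM_pow (hloc : IsLocalInteraction loc h) (hκ0 : 0 < κ) (hr : 1 < r)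
    (hκ : WeightBound (fun X => ‖h X‖) r κ) (n : ℕ) : ∀ (Y : Finset L) (a : 𝔄), a ∈ loc Y →
      ∃ l, Tendsto (fun Λ => (adCLM (boxSum h Λ) ^ n) a) atTop (𝓝 l) := by
  induction n with
  | zero => exact fun Y a _ => ⟨a, by simp⟩
  | succ n ih =>
    intro Y a ha
    have hR : 0 < (r - 1) / κ := div_pos (by linarith) hκ0
    -- δ^(n+1) a is the sum of δ^n [h_X, a] over the X ⊆ Λ that meet `Y`. Each summand converges by
    -- induction, and `WeightBound.summable` provides a dominating series in X.
    choose l hl using fun X => ih _ _ (hloc.adCLM_mem (X := X) ha)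
    refine ⟨∑' X : Finset L, if Disjoint X Y then 0 else l X, ?_⟩
    have hsum : ∀ Λ, (adCLM (boxSum h Λ) ^ (n + 1)) a = ∑' X : Finset L,
        if X ∈ Λ.powerset.filter (fun X => ¬ Disjoint X Y) then
          (adCLM (boxSum h Λ) ^ n) (adCLM (h X) a) else 0 := fun Λ => by
      rw [pow_succ, mul_apply_eq_comp, adCLM_boxSum_apply hloc Λ ha, map_sum, tsum_eq_sum
        (s := Λ.powerset.filter fun X => ¬ Disjoint X Y) (fun X hX => if_neg hX)]
      exact Finset.sum_congr rfl fun X hX => (if_pos hX).symm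
    simp only [hsum]
    refine tendsto_tsum_of_dominated_convergence
      (((hκ.summable (fun X => norm_nonneg (h X)) (by linarith) Y).mul_left
        (n.factorial / ((r - 1) / κ) ^ n * (r ^ Y.card * ‖a‖)))) (fun X => ?_)
      (Eventually.of_forall fun Λ X => ?_)
    · by_cases hX : Disjoint X Y
      · simp [hX]
      · refine Tendsto.congr' ?_ (by rw [if_neg hX]; exact hl X)
        filter_upwards [eventually_ge_atTop X] with Λ hΛ
        rw [if_pos (Finset.mem_filter.2 ⟨Finset.mem_powerset.2 hΛ, hX⟩)]
    · by_cases hX : X ∈ Λ.powerset.filter fun X => ¬ Disjoint X Y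
      · rw [if_pos hX, if_neg (Finset.mem_filter.1 hX).2]
        refine (norm_adCLM_pow_le hloc hκ0 hr hκ Λ n (hloc.adCLM_mem ha)).trans ?_
        rw [mul_assoc]
        refine mul_le_mul_of_nonneg_left ?_ (by positivity)
        have h1 : ‖adCLM (h X) a‖ ≤ 2 * ‖h X‖ * ‖a‖ :=
          Seminorm.adCLM_le (normSeminorm ℂ 𝔄) (fun b => norm_mul_le (h X) b)
            (fun b => (norm_mul_le b (h X)).trans_eq (mul_comm _ _)) a
        calc r ^ (Y ∪ X).card * ‖adCLM (h X) a‖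
            ≤ r ^ (Y.card + X.card) * (2 * ‖h X‖ * ‖a‖) := by
              gcongr
              · exact hr.le
              · exact Finset.card_union_le _ _
          _ = _ := by rw [pow_add]; ring
      · rw [if_neg hX, norm_zero]
        split_ifs
        · simp
        · positivity

/-- In the disc of radius `(r - 1) / κ` the evolution of a local element converges to a holomorphic
function. -/
theorem exists_tendsto_evolution_ball (hloc : IsLocalInteraction loc h) (hκ0 : 0 < κ) (hr : 1 < r)
    (hκ : WeightBound (fun X => ‖h X‖) r κ) {Y : Finset L} {a : 𝔄} (ha : a ∈ loc Y) :
    ∃ g : ℂ → 𝔄, DifferentiableOn ℂ g (Metric.ball 0 ((r - 1) / κ)) ∧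
      ∀ z ∈ Metric.ball (0 : ℂ) ((r - 1) / κ),
        Tendsto (fun Λ => evolution (boxSum h Λ) z a) atTop (𝓝 (g z)) := by
  choose l hl using fun n => exists_tendsto_adCLM_pow hloc hκ0 hr hκ n Y a ha
  have hR : 0 < (r - 1) / κ := div_pos (by linarith) hκ0
  set R := (r - 1) / κ with hRdef
  set C := r ^ Y.card * ‖a‖ with hC
  have hC0 : 0 ≤ C := by positivity
  -- The factorials cancel and leave a geometric bound. It serves both for the finite-volume
  -- coefficients and for their limits `l n`.
  have hterm : ∀ (n : ℕ) (z : ℂ) (b : 𝔄) (ρ : ℝ), ‖z‖ ≤ ρ → ‖b‖ ≤ n.factorial / R ^ n * C →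
      ‖((Complex.I * z) ^ n / n.factorial : ℂ) • b‖ ≤ (ρ / R) ^ n * C := by
    intro n z b ρ hz hb
    rw [norm_smul, norm_div, norm_pow, norm_mul, Complex.norm_I, one_mul, Complex.norm_natCast]
    calc ‖z‖ ^ n / n.factorial * ‖b‖ ≤ ρ ^ n / n.factorial * (n.factorial / R ^ n * C) := by
          have hρ : 0 ≤ ρ := (norm_nonneg z).trans hz
          gcongr
      _ = (ρ / R) ^ n * C := by
          rw [← mul_assoc, div_mul_div_cancel₀ (by positivity), div_pow ρ R]
  have hgeom : ∀ ρ, 0 ≤ ρ → ρ < R → Summable fun n : ℕ => (ρ / R) ^ n * C := fun ρ h0 h1 =>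
    (summable_geometric_of_lt_one (by positivity) ((div_lt_one hR).2 h1)).mul_right C
  have hlb : ∀ n, ‖l n‖ ≤ n.factorial / R ^ n * C := fun n =>
    le_of_tendsto (hl n).norm (Eventually.of_forall fun Λ =>
      norm_adCLM_pow_le hloc hκ0 hr hκ Λ n ha)
  refine ⟨fun z => ∑' n : ℕ, ((Complex.I * z) ^ n / n.factorial : ℂ) • l n, fun z hz => ?_,
    fun z hz => ?_⟩
  · rw [mem_ball_zero_iff] at hz
    obtain ⟨ρ, hzρ, hρ⟩ := exists_between hz
    have hρ0 : 0 ≤ ρ := (norm_nonneg z).trans hzρ.le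
    have := Complex.differentiableOn_tsum_of_summable_norm (hgeom ρ hρ0 hρ)
      (F := fun (n : ℕ) (z : ℂ) => ((Complex.I * z) ^ n / n.factorial : ℂ) • l n)
      (U := Metric.ball 0 ρ) (fun n => by fun_prop) Metric.isOpen_ball
      (fun n w hw => hterm n w _ ρ (mem_ball_zero_iff.1 hw).le (hlb n))
    exact (this.differentiableAt (Metric.isOpen_ball.mem_nhds
      (mem_ball_zero_iff.2 hzρ))).differentiableWithinAt
  · rw [mem_ball_zero_iff] at hz
    have h1 : ∀ Λ, evolution (boxSum h Λ) z a = ∑' n : ℕ,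
        ((Complex.I * z) ^ n / n.factorial : ℂ) • (adCLM (boxSum h Λ) ^ n) a :=
      fun Λ => (hasSum_evolution _ _ _).tsum_eq.symm
    simp only [h1]
    exact tendsto_tsum_of_dominated_convergence (hgeom ‖z‖ (norm_nonneg z) hz)
      (fun n => (hl n).const_smul _) (Eventually.of_forall fun Λ n =>
        hterm n z _ _ le_rfl (norm_adCLM_pow_le hloc hκ0 hr hκ Λ n ha))

end Limit

/-! ### From small times and local elements to all real times. -/

section RealTime

variable {𝔄 : Type*} [CStarAlgebra 𝔄] {ι : Type*}

/-- Real-time evolutions are isometries, so the error from replacing `b Λ` by `b₀` has norm `‖b Λ -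
b₀‖`. This makes limits of evolutions composable. -/
theorem tendsto_evolution_of_tendsto {F : Filter ι} {H : ι → 𝔄} (hH : ∀ i, IsSelfAdjoint (H i))
    {t : ℝ} {b : ι → 𝔄} {b₀ l : 𝔄}
    (hb : Tendsto b F (𝓝 b₀))
    (hl : Tendsto (fun Λ => evolution (H Λ) t b₀) F (𝓝 l)) :
    Tendsto (fun Λ => evolution (H Λ) t (b Λ)) F (𝓝 l) := by
  have h1 : Tendsto (fun Λ => evolution (H Λ) t (b Λ - b₀)) F (𝓝 0) := by
    rw [tendsto_zero_iff_norm_tendsto_zero]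
    simp only [norm_evolution (hH _)]
    rw [← tendsto_zero_iff_norm_tendsto_zero, ← sub_self b₀]
    exact hb.sub_const b₀
  have := h1.add hl
  simpa only [← evolution_map_add, sub_add_cancel, zero_add] using this

/-- An ε/3 argument: evolutions are isometries, so the Cauchy property passes from `S` to its
closure. -/
theorem exists_tendsto_evolution_of_dense [Nonempty ι] [SemilatticeSup ι] {H : ι → 𝔄}
    (hH : ∀ i, IsSelfAdjoint (H i)) {t : ℝ} {S : Set 𝔄} (hS : Dense S)
    (hl : ∀ a ∈ S, ∃ l, Tendsto (fun Λ => evolution (H Λ) t a) atTop (𝓝 l)) (a : 𝔄) :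
    ∃ l, Tendsto (fun Λ => evolution (H Λ) t a) atTop (𝓝 l) := by
  refine cauchySeq_tendsto_of_complete (Metric.cauchySeq_iff'.2 fun ε hε => ?_)
  obtain ⟨b, hb, hbS⟩ := Metric.dense_iff.1 hS a (ε / 3) (by positivity)
  obtain ⟨l, hl⟩ := hl b hbS
  obtain ⟨Λ₀, hΛ₀⟩ := Metric.cauchySeq_iff'.1 hl.cauchySeq (ε / 3) (by positivity)
  refine ⟨Λ₀, fun Λ hΛ => ?_⟩
  have hd : ∀ Λ, dist (evolution (H Λ) t a) (evolution (H Λ) t b) < ε / 3 := fun Λ => by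
    rw [dist_eq_norm, ← evolution_map_sub, norm_evolution (hH Λ), ← dist_eq_norm, dist_comm]
    exact hb
  have h1 := hd Λ
  have h2 := hd Λ₀
  have h3 := hΛ₀ Λ hΛ
  rw [dist_comm] at h2
  have h4 := dist_triangle4 (evolution (H Λ) t a) (evolution (H Λ) t b) (evolution (H Λ₀) t b)
    (evolution (H Λ₀) t a)
  linarith

/-- The time `t` is cut into `m` steps shorter than `R`, and limits are composed by the group law.
-/
theorem exists_tendsto_evolution_of_small {F : Filter ι} {H : ι → 𝔄}
    (hH : ∀ i, IsSelfAdjoint (H i)) {R : ℝ} (hR : 0 < R)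
    (hl : ∀ t : ℝ, |t| < R → ∀ a, ∃ l, Tendsto (fun Λ => evolution (H Λ) t a) F (𝓝 l))
    (t : ℝ) (a : 𝔄) : ∃ l, Tendsto (fun Λ => evolution (H Λ) t a) F (𝓝 l) := by
  obtain ⟨m, hm⟩ := exists_nat_gt (|t| / R)
  have hm0 : 0 < (m : ℝ) := lt_of_le_of_lt (by positivity) hm
  have hs : |t / m| < R := by
    rw [abs_div, abs_of_pos hm0, div_lt_iff₀ hm0]
    rw [div_lt_iff₀ hR] at hm
    linarith
  have key : ∀ k : ℕ, ∃ l, Tendsto (fun Λ => evolution (H Λ) ((k * (t / m) : ℝ)) a) F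
      (𝓝 l) := by
    intro k
    induction k with
    | zero => exact ⟨a, by simpa [evolution_zero] using tendsto_const_nhds⟩
    | succ k ih =>
      obtain ⟨b, hb⟩ := ih
      obtain ⟨l, hl⟩ := hl _ hs b
      refine ⟨l, (tendsto_evolution_of_tendsto hH hb hl).congr fun Λ => ?_⟩
      rw [← evolution_add]
      congr 1
      push_cast
      ring
  simpa [mul_div_cancel₀ t hm0.ne'] using key m

end RealTime

/-! ### The limiting automorphism group and its analytic continuation to a strip. -/

section LimitDynamics

variable {𝔄 : Type*} [CStarAlgebra 𝔄] {ι : Type*} {F : Filter ι} {H : ι → 𝔄}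

/-- The evolutions generated by `H i` converge pointwise at all real times. -/
structure HasLimitDynamics (F : Filter ι) (H : ι → 𝔄) : Prop where
  isSelfAdjoint : ∀ i, IsSelfAdjoint (H i)
  exists_tendsto : ∀ (t : ℝ) (a : 𝔄), ∃ l, Tendsto (fun i => evolution (H i) t a) F (𝓝 l)

/-- The limit of the evolutions generated by `H i`. -/
def limitEvolution (F : Filter ι) (H : ι → 𝔄) (t : ℝ) (a : 𝔄) : 𝔄 :=
  limUnder F fun i => evolution (H i) t a

namespace HasLimitDynamics

theorem tendsto (hl : HasLimitDynamics F H) (t : ℝ) (a : 𝔄) :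
    Tendsto (fun i => evolution (H i) t a) F (𝓝 (limitEvolution F H t a)) :=
  tendsto_nhds_limUnder (hl.exists_tendsto t a)

theorem tendsto_of_tendsto (hl : HasLimitDynamics F H) (t : ℝ) {b : ι → 𝔄} {b₀ : 𝔄}
    (hb : Tendsto b F (𝓝 b₀)) :
    Tendsto (fun i => evolution (H i) t (b i)) F (𝓝 (limitEvolution F H t b₀)) :=
  tendsto_evolution_of_tendsto hl.isSelfAdjoint hb (hl.tendsto t b₀)

variable [F.NeBot]

theorem limitEvolution_zero (hl : HasLimitDynamics F H) (a : 𝔄) : limitEvolution F H 0 a = a := by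
  refine tendsto_nhds_unique (hl.tendsto 0 a) ?_
  simp [evolution_zero]

theorem limitEvolution_add (hl : HasLimitDynamics F H) (s t : ℝ) (a : 𝔄) :
    limitEvolution F H (s + t) a = limitEvolution F H s (limitEvolution F H t a) := by
  refine tendsto_nhds_unique (hl.tendsto (s + t) a) ?_
  simpa [evolution_add] using hl.tendsto_of_tendsto s (hl.tendsto t a)

theorem limitEvolution_neg_cancel (hl : HasLimitDynamics F H) (t : ℝ) (a : 𝔄) :
    limitEvolution F H (-t) (limitEvolution F H t a) = a := by
  rw [← hl.limitEvolution_add, neg_add_cancel, hl.limitEvolution_zero]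

/-- The limit evolution as a `⋆`-automorphism. -/
def automorphism (hl : HasLimitDynamics F H) (t : ℝ) : 𝔄 ≃⋆ₐ[ℂ] 𝔄 where
  toFun := limitEvolution F H t
  invFun := limitEvolution F H (-t)
  left_inv a := hl.limitEvolution_neg_cancel t a
  right_inv a := by simpa using hl.limitEvolution_neg_cancel (-t) a
  map_mul' a b := tendsto_nhds_unique (hl.tendsto t (a * b)) <| by
    simpa [evolution_map_mul] using (hl.tendsto t a).mul (hl.tendsto t b)
  map_add' a b := tendsto_nhds_unique (hl.tendsto t (a + b)) <| by
    simpa [evolution_map_add] using (hl.tendsto t a).add (hl.tendsto t b)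
  map_star' a := tendsto_nhds_unique (hl.tendsto t (star a)) <| by
    simpa [evolution_map_star (hl.isSelfAdjoint _)] using (hl.tendsto t a).star
  map_smul' c a := tendsto_nhds_unique (hl.tendsto t (c • a)) <| by
    simpa [evolution_map_smul] using (hl.tendsto t a).const_smul c

theorem automorphism_apply (hl : HasLimitDynamics F H) (t : ℝ) (a : 𝔄) :
    hl.automorphism t a = limitEvolution F H t a := rfl

theorem norm_limitEvolution (hl : HasLimitDynamics F H) (t : ℝ) (a : 𝔄) :
    ‖limitEvolution F H t a‖ = ‖a‖ := by
  refine tendsto_nhds_unique (hl.tendsto t a).norm ?_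
  simp [norm_evolution (hl.isSelfAdjoint _)]

/-- The limit evolution as a bounded linear map. -/
def clm (hl : HasLimitDynamics F H) (t : ℝ) : 𝔄 →L[ℂ] 𝔄 :=
  LinearMap.mkContinuous
    { toFun := limitEvolution F H t
      map_add' := map_add (hl.automorphism t)
      map_smul' := map_smul (hl.automorphism t) } 1
    fun a => by rw [one_mul]; exact (hl.norm_limitEvolution t a).le

/-- If the evolution of `a` converges to a holomorphic function in a disc around `0`, then it does
so in the strip of the same width. -/
theorem exists_tendsto_strip (hl : HasLimitDynamics F H) {R : ℝ} {a : 𝔄} {g : ℂ → 𝔄}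
    (hg : DifferentiableOn ℂ g (Metric.ball 0 R))
    (hga : ∀ z ∈ Metric.ball (0 : ℂ) R, Tendsto (fun i => evolution (H i) z a) F (𝓝 (g z))) :
    ∃ f : ℂ → 𝔄, DifferentiableOn ℂ f {z | |z.im| < R} ∧
      ∀ z : ℂ, |z.im| < R → Tendsto (fun i => evolution (H i) z a) F (𝓝 (f z)) := by
  have key : ∀ (t : ℝ) (z : ℂ), z - t ∈ Metric.ball (0 : ℂ) R →
      Tendsto (fun i => evolution (H i) z a) F (𝓝 (hl.clm t (g (z - t)))) := fun t z hz =>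
    (hl.tendsto_of_tendsto t (hga _ hz)).congr fun i => by
      rw [← evolution_add, add_sub_cancel]
  have hmem : ∀ z : ℂ, |z.im| < R → z - (z.re : ℂ) ∈ Metric.ball (0 : ℂ) R := fun z hz => by
    have : z - (z.re : ℂ) = z.im * Complex.I := by
      apply Complex.ext <;> simp
    rwa [mem_ball_zero_iff, this, norm_mul, Complex.norm_I, mul_one, Complex.norm_real,
      Real.norm_eq_abs]
  refine ⟨fun z => hl.clm z.re (g (z - z.re)), fun z hz => ?_, fun z hz => key _ _ (hmem z hz)⟩
  have hopen : IsOpen {z : ℂ | |z.im| < R} := isOpen_lt Complex.continuous_im.abs continuous_const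
  -- The base time Re z in the definition of the limit varies with z, which hides holomorphy. With
  -- the base time frozen, the function is visibly holomorphic, and near z it agrees with the limit
  -- because limits are unique.
  have h1 : DifferentiableAt ℂ (fun w => hl.clm z.re (g (w - z.re))) z := by
    refine (hl.clm z.re).differentiableAt.comp z ?_
    have h2 : DifferentiableAt ℂ g (z - z.re) :=
      hg.differentiableAt (Metric.isOpen_ball.mem_nhds (hmem z hz))
    exact h2.comp z (differentiableAt_id.sub_const _)
  refine (h1.congr_of_eventuallyEq ?_).differentiableWithinAt
  have h3 : ∀ᶠ w in 𝓝 z, w - (z.re : ℂ) ∈ Metric.ball (0 : ℂ) R :=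
    (continuous_id.sub continuous_const).continuousAt.eventually_mem
      (Metric.isOpen_ball.mem_nhds (hmem z hz))
  filter_upwards [hopen.mem_nhds hz, h3] with w hw hw'
  exact tendsto_nhds_unique (key _ _ (hmem w hw)) (key _ _ hw')

end HasLimitDynamics

end LimitDynamics

/-! ### Consequences for local interactions. -/

section LocalInteraction

variable {L : Type*} [DecidableEq L] {𝔄 : Type*} [CStarAlgebra 𝔄]
  {loc : Finset L → Subalgebra ℂ 𝔄} {h : Finset L → 𝔄} {r κ : ℝ}

/-- Density comes before the iteration in time: an evolved local element need not be local, so the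
small-time step must be available for every element. -/
theorem IsLocalInteraction.hasLimitDynamics (hloc : IsLocalInteraction loc h)
    (hsa : ∀ X, IsSelfAdjoint (h X)) (hdense : Dense (⋃ Y, (loc Y : Set 𝔄))) (hκ0 : 0 < κ)
    (hr : 1 < r) (hκ : WeightBound (fun X => ‖h X‖) r κ) :
    HasLimitDynamics atTop (boxSum h) := by
  have hH : ∀ Λ, IsSelfAdjoint (boxSum h Λ) := fun Λ => isSelfAdjoint_sum _ fun X _ => hsa X
  refine ⟨hH, exists_tendsto_evolution_of_small hH (R := (r - 1) / κ)
    (div_pos (by linarith) hκ0) fun t ht => exists_tendsto_evolution_of_dense hH hdense ?_⟩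
  intro a ha
  obtain ⟨Y, hY⟩ := Set.mem_iUnion.1 ha
  obtain ⟨g, -, hg⟩ := exists_tendsto_evolution_ball hloc hκ0 hr hκ hY
  exact ⟨g t, hg t (by simpa using ht)⟩

/-- In the strip `|Im z| < (r - 1) / κ` the evolution of a local element converges to a holomorphic
function. -/
theorem IsLocalInteraction.exists_tendsto_strip (hloc : IsLocalInteraction loc h)
    (hl : HasLimitDynamics atTop (boxSum h)) (hκ0 : 0 < κ) (hr : 1 < r)
    (hκ : WeightBound (fun X => ‖h X‖) r κ) {Y : Finset L} {a : 𝔄} (ha : a ∈ loc Y) :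
    ∃ f : ℂ → 𝔄, DifferentiableOn ℂ f {z | |z.im| < (r - 1) / κ} ∧
      ∀ z : ℂ, |z.im| < (r - 1) / κ →
        Tendsto (fun Λ => evolution (boxSum h Λ) z a) atTop (𝓝 (f z)) := by
  obtain ⟨g, hg, hga⟩ := exists_tendsto_evolution_ball hloc hκ0 hr hκ ha
  exact hl.exists_tendsto_strip hg hga

/-- Comparison of the evolution of a local element at imaginary time with the element itself, in any
continuous seminorm for which the terms of the interaction act as bounded operators. -/
theorem IsLocalInteraction.seminorm_evolution_sub_le (hloc : IsLocalInteraction loc h)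
    (p : Seminorm ℂ 𝔄) (hp : Continuous p) {c : Finset L → ℝ}
    (hc : ∀ X, 0 ≤ c X) (hl : ∀ X b, p (h X * b) ≤ c X * p b)
    (hr : ∀ X b, p (b * h X) ≤ c X * p b) (hκ0 : 0 ≤ κ) (hκ : WeightBound c r κ)
    (Λ : Finset L) {x : L} {a : 𝔄} (ha : a ∈ loc {x}) (z : ℂ) (hz : 1 + κ * ‖z‖ ≤ r) :
    p (evolution (boxSum h Λ) z a - a) ≤ κ * ‖z‖ * p a := by
  have h1 := ((hasSum_evolution (boxSum h Λ) z a).tendsto_sum_nat.comp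
    (tendsto_add_atTop_nat 1)).sub_const a
  have h2 := (hp.tendsto _).comp h1
  refine le_of_tendsto h2 (Eventually.of_forall fun M => ?_)
  -- For one site the majorant is (1 + κ‖z‖) p(a). Its summand p(a) is the term n = 0, which the
  -- subtraction of `a` removes.
  have h3 := sum_adCLM_pow_le hloc p hc hl hr hκ0 hκ Λ (M + 1) {x} a ha ‖z‖ (norm_nonneg z) hz
  rw [Finset.sum_range_succ'] at h3
  simp only [Function.comp_apply, Finset.sum_range_succ', pow_zero, Nat.factorial_zero,
    Nat.cast_one, div_one, one_smul, one_apply_eq_self, add_sub_cancel_right, Finset.card_singleton,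
    pow_one, one_mul] at h3 ⊢
  refine (Finset.le_sum_of_subadditive p (map_zero p).le (map_add_le_add p) _ _).trans ?_
  refine le_trans (le_of_eq (Finset.sum_congr rfl fun n _ => ?_)) (by linarith :
    ∑ n ∈ Finset.range M, ‖z‖ ^ (n + 1) / ((n + 1).factorial : ℝ) *
      p ((adCLM (boxSum h Λ) ^ (n + 1)) a) ≤ κ * ‖z‖ * p a)
  rw [map_smul_eq_mul, norm_div, norm_pow, norm_mul, Complex.norm_I, one_mul, Complex.norm_natCast]

end LocalInteraction

/-! ### Weyl operators and the ℓ¹-norm of Weyl coefficients. -/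

section Weyl

open scoped Matrix.Norms.L2Operator ComplexConjugate

variable {G : Type*} [AddCommGroup G] [DecidableEq G]

/-- The Weyl operator on `ℂ^G`: multiplication by the character `ψ`, then translation by `a`. -/
def weyl (a : G) (ψ : AddChar G ℂ) : Matrix G G ℂ :=
  Matrix.of fun σ τ => if σ = τ + a then ψ τ else 0

theorem weyl_apply (a : G) (ψ : AddChar G ℂ) (σ τ : G) :
    weyl a ψ σ τ = if σ = τ + a then ψ τ else 0 := rfl

theorem weyl_zero_one : weyl (0 : G) (1 : AddChar G ℂ) = 1 := by
  ext σ τ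
  simp [weyl_apply, Matrix.one_apply]

variable [Fintype G]

theorem weyl_mul (a b : G) (ψ χ : AddChar G ℂ) :
    weyl a ψ * weyl b χ = ψ b • weyl (a + b) (ψ * χ) := by
  ext σ τ
  simp only [Matrix.mul_apply, weyl_apply, mul_ite, mul_zero, Finset.sum_ite_eq',
    Finset.mem_univ, if_true, Matrix.smul_apply, smul_eq_mul, AddChar.mul_apply]
  have : τ + b + a = τ + (a + b) := by abel
  rw [this]
  split_ifs
  · rw [AddChar.map_add_eq_mul]; ring
  · simp

theorem weyl_mem_unitary (a : G) (ψ : AddChar G ℂ) : weyl a ψ ∈ unitary (Matrix G G ℂ) := by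
  have h1 : star (weyl a ψ) * weyl a ψ = 1 := by
    ext σ τ
    simp only [Matrix.star_eq_conjTranspose, Matrix.mul_apply, Matrix.conjTranspose_apply,
      weyl_apply, mul_ite, mul_zero, Finset.sum_ite_eq', Finset.mem_univ,
      if_true, Matrix.one_apply, add_left_inj]
    by_cases h : σ = τ
    · subst h
      simp [← Complex.normSq_eq_conj_mul_self, Complex.normSq_eq_norm_sq]
    · simp [h, Ne.symm h]
  exact ⟨h1, mul_eq_one_comm.1 h1⟩

theorem norm_weyl_le (a : G) (ψ : AddChar G ℂ) : ‖weyl a ψ‖ ≤ 1 := by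
  have := CStarRing.norm_of_mem_unitary (weyl_mem_unitary a ψ)
  exact this.le

/-- A column is the image of a unit vector. -/
theorem sum_norm_sq_col_le {m n : Type*} [Fintype m] [Fintype n] [DecidableEq n]
    (M : Matrix m n ℂ) (j : n) : ∑ i, ‖M i j‖ ^ 2 ≤ ‖M‖ ^ 2 := by
  have h1 := Matrix.l2_opNorm_mulVec M (EuclideanSpace.single j 1)
  have h2 : ‖EuclideanSpace.single (𝕜 := ℂ) j 1‖ = 1 := by simp
  rw [h2, mul_one] at h1
  have h3 := pow_le_pow_left₀ (norm_nonneg _) h1 2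
  rw [EuclideanSpace.norm_sq_eq] at h3
  simpa using h3

/-- The coefficients of a matrix in the basis of Weyl operators. -/
def weylCoeff (M : Matrix G G ℂ) (a : G) (ψ : AddChar G ℂ) : ℂ :=
  (Fintype.card G : ℂ)⁻¹ * ∑ τ, M (τ + a) τ * ψ (-τ)

/-- Fourier inversion on each shifted diagonal `τ ↦ M (τ + a) τ`. -/
theorem sum_weylCoeff_smul (M : Matrix G G ℂ) :
    ∑ a, ∑ ψ, weylCoeff M a ψ • weyl a ψ = M := by
  ext σ τ
  have h1 : ∀ a : G, (∑ ψ : AddChar G ℂ, weylCoeff M a ψ • weyl a ψ) σ τ =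
      if σ = τ + a then M (τ + a) τ else 0 := fun a => by
    simp only [Matrix.sum_apply, Matrix.smul_apply, weyl_apply, smul_eq_mul, mul_ite, mul_zero,
      weylCoeff]
    split_ifs with h
    · simp only [mul_assoc, Finset.sum_mul, ← AddChar.map_add_eq_mul, ← Finset.mul_sum]
      rw [Finset.sum_comm]
      simp only [← Finset.mul_sum, AddChar.sum_apply_eq_ite, neg_add_eq_zero, mul_ite, mul_zero,
        Finset.sum_ite_eq', Finset.mem_univ, if_true]
      have : (Fintype.card G : ℂ) ≠ 0 := by simp
      field_simp
    · simp
  simp only [Matrix.sum_apply] at h1 ⊢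
  simp only [h1]
  rw [Finset.sum_eq_single (σ - τ)]
  · simp
  · intro b _ hb
    rw [if_neg]
    rintro rfl
    simp at hb
  · simp

/-- Parseval's identity on a shifted diagonal. -/
theorem sum_norm_sq_weylCoeff (M : Matrix G G ℂ) (a : G) :
    ∑ ψ, ‖weylCoeff M a ψ‖ ^ 2 = (Fintype.card G : ℝ)⁻¹ * ∑ τ, ‖M (τ + a) τ‖ ^ 2 := by
  have hc : (Fintype.card G : ℂ) ≠ 0 := by simp
  have hconj : ∀ (ψ : AddChar G ℂ) (x : G), conj (ψ (-x)) = ψ x := fun ψ x => by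
    rw [AddChar.map_neg_eq_conj, Complex.conj_conj]
  have h1 : ∀ ψ : AddChar G ℂ, ((‖weylCoeff M a ψ‖ ^ 2 : ℝ) : ℂ) = (Fintype.card G : ℂ)⁻¹ ^ 2 *
      ∑ τ, ∑ τ', M (τ + a) τ * conj (M (τ' + a) τ') * ψ (-τ + τ') := fun ψ => by
    push_cast
    rw [← Complex.mul_conj', weylCoeff, map_mul, map_sum, map_inv₀, Complex.conj_natCast]
    simp only [map_mul, hconj]
    rw [mul_mul_mul_comm, ← sq, Finset.sum_mul_sum]
    congr 1
    refine Finset.sum_congr rfl fun τ _ => Finset.sum_congr rfl fun τ' _ => ?_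
    rw [AddChar.map_add_eq_mul]
    ring
  have h2 : ((∑ ψ, ‖weylCoeff M a ψ‖ ^ 2 : ℝ) : ℂ) =
      (((Fintype.card G : ℝ)⁻¹ * ∑ τ, ‖M (τ + a) τ‖ ^ 2 : ℝ) : ℂ) := by
    rw [Complex.ofReal_sum]
    simp only [h1]
    rw [← Finset.mul_sum, Finset.sum_comm]
    have h3 : ∀ τ : G, ∑ ψ : AddChar G ℂ, ∑ τ', M (τ + a) τ * conj (M (τ' + a) τ') * ψ (-τ + τ') =
        Fintype.card G * (‖M (τ + a) τ‖ ^ 2 : ℝ) := fun τ => by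
      rw [Finset.sum_comm]
      simp only [← Finset.mul_sum, AddChar.sum_apply_eq_ite, neg_add_eq_zero, mul_ite, mul_zero,
        Finset.sum_ite_eq, Finset.mem_univ, if_true]
      push_cast
      rw [Complex.mul_conj']
      ring
    simp only [h3, ← Finset.mul_sum]
    push_cast
    field_simp
  exact_mod_cast h2

/-- The `ℓ¹`-norm of the Weyl coefficients is at most `|G|` times the operator norm. -/
theorem sum_norm_weylCoeff_le (M : Matrix G G ℂ) :
    ∑ a, ∑ ψ, ‖weylCoeff M a ψ‖ ≤ Fintype.card G * ‖M‖ := by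
  have hc : (0 : ℝ) < Fintype.card G := by exact_mod_cast Fintype.card_pos
  have h1 : ∑ x : G × AddChar G ℂ, ‖weylCoeff M x.1 x.2‖ ^ 2 ≤ ‖M‖ ^ 2 := by
    rw [Fintype.sum_prod_type]
    simp only [sum_norm_sq_weylCoeff]
    rw [← Finset.mul_sum, Finset.sum_comm, inv_mul_le_iff₀ hc]
    calc ∑ τ, ∑ a, ‖M (τ + a) τ‖ ^ 2 = ∑ τ, ∑ σ, ‖M σ τ‖ ^ 2 :=
          Finset.sum_congr rfl fun τ _ =>
            Equiv.sum_comp (Equiv.addLeft τ) fun σ => ‖M σ τ‖ ^ 2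
      _ ≤ ∑ τ : G, ‖M‖ ^ 2 := Finset.sum_le_sum fun τ _ => sum_norm_sq_col_le M τ
      _ = _ := by simp
  rw [← Fintype.sum_prod_type' (f := fun a ψ => ‖weylCoeff M a ψ‖)]
  refine (pow_le_pow_iff_left₀ (by positivity) (by positivity) two_ne_zero).1 ?_
  -- Cauchy–Schwarz over the |G|² pairs of a translation and a character; the square root of |G|² is
  -- the constant.
  refine (sq_sum_le_card_mul_sum_sq).trans ?_
  rw [Finset.card_univ, Fintype.card_prod, AddChar.card_eq, mul_pow]
  push_cast
  rw [← sq]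
  gcongr

end Weyl

/-! ### The net of local algebras in the quasi-local algebra. -/

section LocalNet

theorem Interaction.norm_mono {L : Type u} [DecidableEq L] {N : ℕ} (Φ : Interaction L N) {r r' : ℝ≥0}
    (h : r ≤ r') : Φ.norm r ≤ Φ.norm r' := by
  unfold Interaction.norm
  gcongr

variable {L : Type u} [DecidableEq L] {N : ℕ} [NeZero N]

/-- The algebra of observables local in `Y`, inside the quasi-local algebra. -/
def localNet (N : ℕ) [NeZero N] (Y : Finset L) : Subalgebra ℂ (QuasiLocalAlgebra L N) :=
  (incl Y).toAlgHom.range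

theorem incl_mem_localNet (Y : Finset L) (A : BoxAlgebra N Y) : incl Y A ∈ localNet N Y :=
  ⟨A, rfl⟩

theorem localNet_mono {X Y : Finset L} (h : X ⊆ Y) : localNet (L := L) N X ≤ localNet N Y := by
  rintro _ ⟨A, rfl⟩
  exact ⟨extend h A, incl_extend h A⟩

theorem mem_localObservables {a : QuasiLocalAlgebra L N} :
    a ∈ localObservables L N ↔ ∃ Y, a ∈ localNet N Y := by
  constructor
  · rintro ⟨b, rfl⟩
    obtain ⟨Λ, A, rfl⟩ := LocalAlgebra.exists_mk b
    exact ⟨Λ, A, rfl⟩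
  · rintro ⟨Y, A, rfl⟩
    exact ⟨_, rfl⟩

theorem localObservables_eq : localObservables L N =
    ⋃ Y : Finset L, (localNet (L := L) N Y : Set (QuasiLocalAlgebra L N)) := by
  ext a
  simp [mem_localObservables]

theorem dense_localObservables : Dense (localObservables L N) :=
  QuasiLocalAlgebra.denseRange_ofLocal

/-- Restriction of configurations, as a homomorphism for the group structure of `Fin N`. -/
def restrictHom (N : ℕ) [NeZero N] {Λ Λ' : Finset L} (h : Λ ⊆ Λ') :
    (Λ' → Fin N) →+ (Λ → Fin N) where
  toFun σ x := σ ⟨x.1, h x.2⟩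
  map_zero' := rfl
  map_add' _ _ := rfl

/-- Extension of configurations by zero. -/
def extendHom (N : ℕ) [NeZero N] (Λ Λ' : Finset L) : (Λ → Fin N) →+ (Λ' → Fin N) where
  toFun a x := if hx : x.1 ∈ Λ then a ⟨x.1, hx⟩ else 0
  map_zero' := by ext x; simp
  map_add' a b := by
    funext x
    by_cases hx : x.1 ∈ Λ <;> simp [hx]

theorem restrictHom_apply {L : Type u} {N : ℕ} [NeZero N] {Λ Λ' : Finset L} (h : Λ ⊆ Λ')
    (σ : Λ' → Fin N) (x : Λ) : restrictHom N h σ x = σ ⟨x.1, h x.2⟩ := rfl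

theorem extendHom_apply {Λ Λ' : Finset L} (a : Λ → Fin N) (x : Λ') :
    extendHom N Λ Λ' a x = if hx : x.1 ∈ Λ then a ⟨x.1, hx⟩ else 0 := rfl

/-- Tensoring with `1` keeps an operator Weyl: the translation is extended by zero and the character
ignores the new sites. Products can thus be computed in any common box. -/
theorem extend_weyl {Λ Λ' : Finset L} (h : Λ ⊆ Λ') (a : Λ → Fin N) (ψ : AddChar (Λ → Fin N) ℂ) :
    extend h (weyl a ψ) =
      weyl (extendHom N Λ Λ' a) (ψ.compAddMonoidHom (restrictHom N h)) := by
  ext σ τ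
  rw [extend_apply, weyl_apply, weyl_apply]
  have key : σ = τ + extendHom N Λ Λ' a ↔ (∀ x : Λ', x.1 ∉ Λ → σ x = τ x) ∧
      (fun x : Λ => σ ⟨x.1, h x.2⟩) = (fun x => τ ⟨x.1, h x.2⟩) + a := by
    constructor
    · rintro rfl
      refine ⟨fun x hx => ?_, ?_⟩
      · simp [extendHom_apply, hx]
      · funext x
        simp [extendHom_apply]
    · rintro ⟨h1, h2⟩
      funext x
      by_cases hx : x.1 ∈ Λ
      · simpa [extendHom_apply, hx] using congrFun h2 ⟨x.1, hx⟩
      · simpa [extendHom_apply, hx] using h1 x hx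
  by_cases h1 : ∀ x : Λ', x.1 ∉ Λ → σ x = τ x
  · rw [if_pos h1]
    by_cases h2 : (fun x : Λ => σ ⟨x.1, h x.2⟩) = (fun x => τ ⟨x.1, h x.2⟩) + a
    · rw [if_pos h2, if_pos (key.2 ⟨h1, h2⟩)]
      rfl
    · rw [if_neg h2, if_neg fun h3 => h2 (key.1 h3).2]
  · rw [if_neg h1, if_neg fun h2 => h1 (key.1 h2).1]

theorem incl_weyl {Λ Λ' : Finset L} (h : Λ ⊆ Λ') (a : Λ → Fin N) (ψ : AddChar (Λ → Fin N) ℂ) :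
    incl Λ (weyl a ψ) =
      incl Λ' (weyl (extendHom N Λ Λ' a) (ψ.compAddMonoidHom (restrictHom N h))) := by
  rw [← extend_weyl h, incl_extend]

theorem incl_eq_sum_weyl {Λ : Finset L} (A : BoxAlgebra N Λ) :
    incl Λ A = ∑ a, ∑ ψ, weylCoeff A a ψ • incl Λ (weyl a ψ) := by
  conv_lhs => rw [← sum_weylCoeff_smul A]
  simp only [map_sum, map_smul]

/-- In the box `X ∪ Y` the two orders differ only by the phases ψ(b) and χ(a), both `1` because the
supports are disjoint. -/
theorem commute_incl_weyl {X Y : Finset L} (hXY : Disjoint X Y) (a : X → Fin N)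
    (ψ : AddChar (X → Fin N) ℂ) (b : Y → Fin N) (χ : AddChar (Y → Fin N) ℂ) :
    Commute (incl X (weyl a ψ)) (incl Y (weyl b χ)) := by
  have h1 : restrictHom N (Finset.subset_union_left (s₁ := X) (s₂ := Y))
      (extendHom N Y (X ∪ Y) b) = 0 := by
    funext x
    simp [restrictHom_apply, extendHom_apply, Finset.disjoint_left.1 hXY x.2]
  have h2 : restrictHom N (Finset.subset_union_right (s₁ := X) (s₂ := Y))
      (extendHom N X (X ∪ Y) a) = 0 := by
    funext x
    simp [restrictHom_apply, extendHom_apply, Finset.disjoint_right.1 hXY x.2]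
  rw [incl_weyl (Finset.subset_union_left (s₂ := Y)) a ψ,
    incl_weyl (Finset.subset_union_right (s₁ := X)) b χ,
    commute_iff_eq, ← map_mul, ← map_mul, weyl_mul, weyl_mul, AddChar.compAddMonoidHom_apply,
    AddChar.compAddMonoidHom_apply, h1, h2, AddChar.map_zero_eq_one, AddChar.map_zero_eq_one,
    add_comm, mul_comm]

theorem commute_incl {X Y : Finset L} (hXY : Disjoint X Y) (A : BoxAlgebra N X)
    (B : BoxAlgebra N Y) : Commute (incl X A) (incl Y B) := by
  rw [incl_eq_sum_weyl A, incl_eq_sum_weyl B]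
  refine Commute.sum_left _ _ _ fun a _ => Commute.sum_left _ _ _ fun ψ _ =>
    Commute.sum_right _ _ _ fun b _ => Commute.sum_right _ _ _ fun χ _ => ?_
  exact ((commute_incl_weyl hXY a ψ b χ).smul_left _).smul_right _

/-- The terms of an interaction, in the quasi-local algebra. -/
def Interaction.term (Φ : Interaction L N) (X : Finset L) : QuasiLocalAlgebra L N :=
  incl X (Φ.op X)

theorem Interaction.isLocalInteraction (Φ : Interaction L N) :
    IsLocalInteraction (localNet N) Φ.term where
  mono h := localNet_mono h
  commute := by
    rintro X Y hXY _ ⟨A, rfl⟩ _ ⟨B, rfl⟩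
    exact commute_incl hXY A B
  mem X := incl_mem_localNet X _

theorem Interaction.isSelfAdjoint_term (Φ : Interaction L N) (X : Finset L) :
    IsSelfAdjoint (Φ.term X) := by
  have : IsSelfAdjoint (Φ.op X) := Φ.isHermitian X
  exact this.map (incl X)

theorem Interaction.norm_term (Φ : Interaction L N) (X : Finset L) : ‖Φ.term X‖ = ‖Φ.op X‖ :=
  norm_incl X _

/-- A finite `‖Φ‖_{mr}` bounds the weights `‖Φ_X‖ m^|X|` at parameter `r`. -/
theorem Interaction.weightBound (Φ : Interaction L N) {m r : ℝ≥0} {κ : ℝ≥0}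
    (h : 2 * Φ.norm (m * r) ≤ κ) :
    WeightBound (fun X => ‖Φ.term X‖ * (m : ℝ) ^ X.card) r κ := by
  intro x S hS
  have h1 : ∑ X ∈ S, ‖Φ.op X‖ₑ * ((m * r : ℝ≥0) : ℝ≥0∞) ^ X.card ≤ Φ.norm (m * r) := by
    refine le_trans ?_ (le_iSup _ x)
    rw [← Finset.sum_attach]
    let f : {X // X ∈ S} ↪ {X : Finset L // x ∈ X} :=
      ⟨fun X => ⟨X.1, hS X.1 X.2⟩, fun X Y hXY => Subtype.ext (by simpa using hXY)⟩
    refine le_trans (le_of_eq ?_) (ENNReal.sum_le_tsum (S.attach.map f))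
    rw [Finset.sum_map]
    rfl
  have h2 : 2 * ∑ X ∈ S, ‖Φ.op X‖ₑ * ((m * r : ℝ≥0) : ℝ≥0∞) ^ X.card ≤ κ :=
    (mul_le_mul_right h1 2).trans h
  have h3 : ((∑ X ∈ S, 2 * ((‖Φ.op X‖₊ * m ^ X.card) * r ^ X.card) : ℝ≥0) : ℝ≥0∞) ≤ κ := by
    refine le_trans (le_of_eq ?_) h2
    rw [Finset.mul_sum]
    push_cast
    refine Finset.sum_congr rfl fun X _ => ?_
    rw [mul_pow, enorm_eq_nnnorm, mul_assoc]
  have h4 : ((∑ X ∈ S, 2 * ((‖Φ.op X‖₊ * m ^ X.card) * r ^ X.card) : ℝ≥0) : ℝ) ≤ κ := by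
    exact_mod_cast h3
  push_cast at h4
  simpa only [Φ.norm_term] using h4

end LocalNet

/-! ### The Weyl group of the lattice and averaging over one site. -/

section WeylSet

variable {L : Type u} [DecidableEq L] {N : ℕ} [NeZero N]

/-- The group of Weyl operators, with phases. -/
def weylSet (L : Type u) [DecidableEq L] (N : ℕ) [NeZero N] : Set (QuasiLocalAlgebra L N) :=
  {w | ∃ (Λ : Finset L) (a : Λ → Fin N) (ψ : AddChar (Λ → Fin N) ℂ) (c : ℂ), ‖c‖ = 1 ∧
    w = c • incl Λ (weyl a ψ)}

theorem incl_weyl_mem (Λ : Finset L) (a : Λ → Fin N) (ψ : AddChar (Λ → Fin N) ℂ) :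
    incl Λ (weyl a ψ) ∈ weylSet L N := ⟨Λ, a, ψ, 1, by simp, by simp⟩

theorem smul_mem_weylSet {c : ℂ} (hc : ‖c‖ = 1) {w : QuasiLocalAlgebra L N} (hw : w ∈ weylSet L N) :
    c • w ∈ weylSet L N := by
  obtain ⟨Λ, a, ψ, c', hc', rfl⟩ := hw
  exact ⟨Λ, a, ψ, c * c', by simp [hc, hc'], by rw [smul_smul]⟩

theorem one_mem_weylSet : (1 : QuasiLocalAlgebra L N) ∈ weylSet L N := by
  have := incl_weyl_mem (N := N) (∅ : Finset L) 0 1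
  rwa [weyl_zero_one, map_one] at this

theorem mul_mem_weylSet {v w : QuasiLocalAlgebra L N} (hv : v ∈ weylSet L N)
    (hw : w ∈ weylSet L N) : v * w ∈ weylSet L N := by
  obtain ⟨X, a, ψ, c, hc, rfl⟩ := hv
  obtain ⟨Y, b, χ, c', hc', rfl⟩ := hw
  rw [incl_weyl (Finset.subset_union_left (s₂ := Y)) a ψ,
    incl_weyl (Finset.subset_union_right (s₁ := X)) b χ,
    smul_mul_smul_comm, ← map_mul, weyl_mul, map_smul]
  exact smul_mem_weylSet (by simp [hc, hc'])
    (smul_mem_weylSet (AddChar.norm_apply _ _) (incl_weyl_mem _ _ _))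

theorem norm_le_one_of_mem_weylSet {w : QuasiLocalAlgebra L N} (hw : w ∈ weylSet L N) :
    ‖w‖ ≤ 1 := by
  obtain ⟨X, a, ψ, c, hc, rfl⟩ := hw
  rw [norm_smul, hc, one_mul, norm_incl]
  exact norm_weyl_le a ψ

theorem sum_extendHom_restrictHom {Λ : Finset L} (σ : Λ → Fin N) :
    ∑ x : Λ, extendHom N {x.1} Λ (restrictHom N (Finset.singleton_subset_iff.2 x.2) σ) = σ := by
  funext y
  rw [Finset.sum_apply, Finset.sum_eq_single y]
  · simp [extendHom_apply, restrictHom_apply]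
  · intro x _ hxy
    have : y.1 ≠ x.1 := fun h => hxy (Subtype.ext h.symm)
    simp [extendHom_apply, this]
  · simp

/-- Configurations are sums of single-site ones, so a translation and a character trivial at every
site are trivial. The `0` among characters is the trivial character. -/
theorem exists_site_of_weyl_ne_one {Λ : Finset L} {a : Λ → Fin N} {ψ : AddChar (Λ → Fin N) ℂ}
    (h : ¬ (a = 0 ∧ ψ = 1)) : ∃ x : Λ, restrictHom N (Finset.singleton_subset_iff.2 x.2) a ≠ 0 ∨
      ψ.compAddMonoidHom (extendHom N {x.1} Λ) ≠ 0 := by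
  by_contra! hcon
  refine h ⟨?_, ?_⟩
  · rw [← sum_extendHom_restrictHom a]
    simp [hcon]
  · rw [AddChar.eq_one_iff]
    intro σ
    rw [← sum_extendHom_restrictHom σ]
    have : ∀ S : Finset Λ, ψ (∑ x ∈ S,
        extendHom N {x.1} Λ (restrictHom N (Finset.singleton_subset_iff.2 x.2) σ)) = 1 := by
      intro S
      induction S using Finset.induction_on with
      | empty => simp
      | insert x S hx ih =>
        rw [Finset.sum_insert hx, AddChar.map_add_eq_mul, ih, mul_one,
          ← AddChar.compAddMonoidHom_apply, (hcon x).2]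
        rfl
    exact this _

/-- The last factor on the left is the inverse of `weyl b χ`, so conjugation only produces a phase.
-/
theorem weyl_conj {G : Type*} [AddCommGroup G] [Fintype G] [DecidableEq G] (a b : G)
    (ψ χ : AddChar G ℂ) :
    weyl b χ * weyl a ψ * (χ b • weyl (-b) χ⁻¹) = (χ a * ψ (-b)) • weyl a ψ := by
  have h0 : χ b * χ (-b) = 1 := by rw [← AddChar.map_add_eq_mul]; simp
  rw [weyl_mul, smul_mul_smul_comm, weyl_mul, smul_smul]
  congr 1
  · rw [AddChar.mul_apply]
    linear_combination χ a * ψ (-b) * h0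
  · congr 1
    · abel
    · rw [mul_comm χ ψ, mul_inv_cancel_right]

theorem weyl_inv_mul {G : Type*} [AddCommGroup G] [Fintype G] [DecidableEq G] (b : G)
    (χ : AddChar G ℂ) : (χ b • weyl (-b) χ⁻¹) * weyl b χ = 1 := by
  have h0 : χ b * χ (-b) = 1 := by rw [← AddChar.map_add_eq_mul]; simp
  rw [smul_mul_assoc, weyl_mul, smul_smul, AddChar.inv_apply, h0, one_smul, neg_add_cancel,
    inv_mul_cancel, weyl_zero_one]

/-- A Weyl operator that is not a scalar is averaged to zero by conjugation with the Weyl operators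
of some site. -/
theorem exists_site_average {w : QuasiLocalAlgebra L N} (hw : w ∈ weylSet L N) :
    (∃ c : ℂ, w = c • 1) ∨ ∃ (x : L) (ι : Type u) (_ : Fintype ι) (_ : Nonempty ι)
      (u v : ι → QuasiLocalAlgebra L N), (∀ k, u k ∈ weylSet L N ∧ v k ∈ weylSet L N ∧
        u k ∈ localNet N {x} ∧ v k * u k = 1) ∧ ∑ k, u k * w * v k = 0 := by
  obtain ⟨Λ, a, ψ, c, hc, rfl⟩ := hw
  by_cases h : a = 0 ∧ ψ = 1
  · left
    refine ⟨c, ?_⟩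
    rw [h.1, h.2, weyl_zero_one, map_one]
  right
  obtain ⟨x, hx⟩ := exists_site_of_weyl_ne_one h
  have hxΛ : {x.1} ⊆ Λ := Finset.singleton_subset_iff.2 x.2
  refine ⟨x, (({x.1} : Finset L) → Fin N) × AddChar (({x.1} : Finset L) → Fin N) ℂ, inferInstance,
    inferInstance, fun k => incl {x.1} (weyl k.1 k.2),
    fun k => incl {x.1} (k.2 k.1 • weyl (-k.1) k.2⁻¹), fun k => ⟨incl_weyl_mem _ _ _, ?_,
      incl_mem_localNet _ _, ?_⟩, ?_⟩
  · dsimp only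
    rw [map_smul]
    exact smul_mem_weylSet (AddChar.norm_apply _ _) (incl_weyl_mem _ _ _)
  · dsimp only
    rw [← map_mul, weyl_inv_mul, map_one]
  · have key : ∀ k : (({x.1} : Finset L) → Fin N) × AddChar (({x.1} : Finset L) → Fin N) ℂ,
        incl {x.1} (weyl k.1 k.2) * (c • incl Λ (weyl a ψ)) *
          incl {x.1} (k.2 k.1 • weyl (-k.1) k.2⁻¹) =
        (ψ.compAddMonoidHom (extendHom N {x.1} Λ) (-k.1) * k.2 (restrictHom N hxΛ a)) •
          (c • incl Λ (weyl a ψ)) := fun k => by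
      have h1 := weyl_conj a (extendHom N {x.1} Λ k.1) ψ (k.2.compAddMonoidHom (restrictHom N hxΛ))
      have h2 : restrictHom N hxΛ (extendHom N {x.1} Λ k.1) = k.1 := by
        funext y
        simp [restrictHom_apply, extendHom_apply]
      rw [AddChar.compAddMonoidHom_apply, AddChar.compAddMonoidHom_apply, h2] at h1
      rw [map_smul, incl_weyl hxΛ, incl_weyl hxΛ, mul_smul_comm, mul_smul_comm, smul_mul_assoc,
        ← map_mul, ← map_mul, smul_comm (k.2 k.1), smul_comm _ c, ← map_smul (incl Λ),
        ← map_smul (incl Λ), mul_comm (ψ.compAddMonoidHom _ _), AddChar.compAddMonoidHom_apply,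
        map_neg, ← map_smul (incl Λ) _ (weyl a ψ), ← map_smul (incl Λ) c, ← h1, mul_smul_comm]
      rfl
    simp only [key, ← Finset.sum_smul]
    rw [Fintype.sum_prod_type]
    simp only [← Finset.mul_sum, ← Finset.sum_mul]
    -- The sum of the phases factors into a sum over translations and a sum over characters. By the
    -- choice of `x`, orthogonality kills one of them.
    have h0 : (∑ b, ψ.compAddMonoidHom (extendHom N {x.1} Λ) (-b)) *
        ∑ χ : AddChar (({x.1} : Finset L) → Fin N) ℂ, χ (restrictHom N hxΛ a) = 0 := by
      rcases hx with hx | hx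
      · rw [AddChar.sum_apply_eq_zero_iff_ne_zero.2 hx, mul_zero]
      · have := Equiv.sum_comp (Equiv.neg _) fun b => ψ.compAddMonoidHom (extendHom N {x.1} Λ) b
        simp only [Equiv.neg_apply] at this
        rw [this, AddChar.sum_eq_zero_iff_ne_zero.2 hx, zero_mul]
    rw [h0, zero_smul]

end WeylSet

/-! ### Gibbs states relative to a tracial state. -/

section Gibbs

variable {𝔄 : Type*} [CStarAlgebra 𝔄]

/-- In the GNS representation ρ(a) = ⟨1, π(a) 1⟩ with a unit vector and ‖π(a)‖ ≤ ‖a‖. The bound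
supplies the compactness used for limits of Gibbs states. -/
theorem norm_apply_le_of_positive (ρ : 𝔄 →L[ℂ] ℂ) (hpos : ∀ a, 0 ≤ ρ (star a * a)) (h1 : ρ 1 = 1)
    (a : 𝔄) : ‖ρ a‖ ≤ ‖a‖ := by
  let _ : PartialOrder 𝔄 := CStarAlgebra.spectralOrder 𝔄
  have _ : StarOrderedRing 𝔄 := CStarAlgebra.spectralOrderedRing 𝔄
  let f : 𝔄 →ₚ[ℂ] ℂ := PositiveLinearMap.mk₀ (ρ : 𝔄 →ₗ[ℂ] ℂ) fun x hx => by
    obtain ⟨b, rfl⟩ := CStarAlgebra.nonneg_iff_eq_star_mul_self.1 hx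
    exact hpos b
  have hf : ∀ x, f x = ρ x := fun _ => rfl
  have h2 : ‖f.toPreGNS 1‖ = 1 := by
    rw [PositiveLinearMap.preGNS_norm_def, PositiveLinearMap.ofPreGNS_toPreGNS, star_one, one_mul,
      hf, h1]
    simp
  have h3 : inner ℂ (f.toPreGNS 1) (f.leftMulMapPreGNS a (f.toPreGNS 1)) = ρ a := by
    rw [PositiveLinearMap.preGNS_inner_def, ← hf]
    simp
  calc ‖ρ a‖ ≤ ‖f.toPreGNS 1‖ * ‖f.leftMulMapPreGNS a (f.toPreGNS 1)‖ := by
        rw [← h3]; exact norm_inner_le_norm _ _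
    _ ≤ ‖f.toPreGNS 1‖ * (‖f.leftMulMapPreGNS a‖ * ‖f.toPreGNS 1‖) := by
        gcongr; exact ContinuousLinearMap.le_opNorm _ _
    _ = ‖f.leftMulMapPreGNS a‖ := by rw [h2]; ring
    _ ≤ ‖a‖ := LinearMap.mkContinuous_norm_le _ (norm_nonneg a) _

/-- The Gibbs state of the Hamiltonian `H`, relative to a tracial state. -/
theorem exists_gibbs_state (τ : 𝔄 →L[ℂ] ℂ) (hpos : ∀ a, 0 ≤ τ (star a * a)) (h1 : τ 1 = 1)
    (htr : ∀ a b, τ (a * b) = τ (b * a)) {H : 𝔄} (hH : IsSelfAdjoint H) (β : ℝ) :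
    ∃ ρ : 𝔄 →L[ℂ] ℂ, (∀ a, 0 ≤ ρ (star a * a)) ∧ ρ 1 = 1 ∧
      ∀ a b, ρ (a * b) = ρ (b * evolution H (Complex.I * β) a) := by
  -- `K` is e^{-βH/2} with inverse `K'`; the state will be a ↦ τ(K a K) / τ(K²).
  set K : 𝔄 := NormedSpace.exp (((-(β / 2) : ℝ) : ℂ) • H) with hK
  set K' : 𝔄 := NormedSpace.exp (-(((-(β / 2) : ℝ) : ℂ) • H)) with hK'
  have hsa : IsSelfAdjoint ((((-(β / 2) : ℝ) : ℂ)) • H) := by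
    rw [isSelfAdjoint_iff, star_smul, hH.star_eq]; simp
  have hKs : star K = K := hsa.exp.star_eq
  have hK's : star K' = K' := hsa.neg.exp.star_eq
  have hKK' : K * K' = 1 := exp_smul_mul_neg _ _
  have hK'K : K' * K = 1 := exp_neg_smul_mul _ _
  have hevo : ∀ a, evolution H (Complex.I * β) a = K * K * a * (K' * K') := fun a => by
    have e1 : (Complex.I * (Complex.I * β)) = ((-(β / 2) : ℝ) : ℂ) + ((-(β / 2) : ℝ) : ℂ) := by
      rw [← mul_assoc, Complex.I_mul_I]; push_cast; ring
    rw [evolution, e1, exp_add_smul, ← neg_smul, neg_add, exp_add_smul, neg_smul]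
  have hZ : 0 < (τ (K * K)).re ∧ τ (K * K) = ((τ (K * K)).re : ℂ) := by
    have hp : ∀ b : 𝔄, star b = b → 0 ≤ (τ (b * b)).re ∧ (τ (b * b)).im = 0 := fun b hb => by
      have := hpos b
      rw [hb] at this
      exact ⟨(Complex.nonneg_iff.1 this).1, (Complex.nonneg_iff.1 this).2.symm⟩
    obtain ⟨hZ0, hZi⟩ := hp K hKs
    refine ⟨lt_of_le_of_ne hZ0 fun hne => ?_, Complex.ext rfl (by simp [hZi])⟩
    obtain ⟨hW0, -⟩ := hp K' hK's
    set W := (τ (K' * K')).re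
    -- The trace is not assumed faithful, so τ(K²) > 0 needs an argument. If τ(K²) = 0, then τ((K -
    -- cK')²) = -2c + c²W, which is negative for this `c`.
    set c : ℝ := (W + 1)⁻¹ with hc
    have hc0 : 0 < c := by positivity
    have hcW : c * (W + 1) = 1 := inv_mul_cancel₀ (by positivity)
    have h2 := (hp (K - (c : ℂ) • K') (by rw [star_sub, star_smul, hKs, hK's]; simp)).1
    have h3 : (K - (c : ℂ) • K') * (K - (c : ℂ) • K') =
        K * K - (2 * c : ℂ) • 1 + ((c : ℂ) ^ 2) • (K' * K') := by
      simp only [sub_mul, mul_sub, smul_mul_assoc, mul_smul_comm, hKK', hK'K, smul_sub, smul_smul]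
      rw [two_mul, add_smul, sq]
      abel
    rw [h3, map_add, map_sub, map_smul, map_smul, h1] at h2
    have h4 : ((τ (K * K) - (2 * c : ℂ) • (1 : ℂ) + ((c : ℂ) ^ 2) • τ (K' * K'))).re =
        (τ (K * K)).re - 2 * c + c ^ 2 * W := by
      simp [W, ← Complex.ofReal_pow]
    rw [h4, ← hne] at h2
    nlinarith
  obtain ⟨hZ0, hZ⟩ := hZ
  set Z : ℝ := (τ (K * K)).re
  let ρ : 𝔄 →L[ℂ] ℂ := ((Z⁻¹ : ℝ) : ℂ) • (τ ∘L ContinuousLinearMap.mulLeftRight ℂ 𝔄 K K)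
  have hρ : ∀ a, ρ a = ((Z⁻¹ : ℝ) : ℂ) * τ (K * a * K) := fun a => rfl
  refine ⟨ρ, fun a => ?_, ?_, fun a b => ?_⟩
  · rw [hρ]
    have : K * (star a * a) * K = star (a * K) * (a * K) := by
      rw [star_mul, hKs]; simp only [mul_assoc]
    rw [this]
    exact mul_nonneg (Complex.zero_le_real.2 (inv_nonneg.2 hZ0.le)) (hpos _)
  · rw [hρ, mul_one, hZ, ← Complex.ofReal_mul, inv_mul_cancel₀ hZ0.ne', Complex.ofReal_one]
  · rw [hρ, hρ, hevo]
    congr 1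
    calc τ (K * (a * b) * K) = τ ((K * a) * (b * K)) := by simp only [mul_assoc]
      _ = τ (b * K * (K * a)) := htr _ _
      _ = τ ((b * (K * K * a * (K' * K'))) * (K * K)) := by
          congr 1
          calc _ = b * K * (K * a) * (K' * 1 * K) := by rw [mul_one, hK'K, mul_one]
            _ = _ := by rw [← hK'K]; simp only [mul_assoc]
      _ = τ (K * (b * (K * K * a * (K' * K'))) * K) := by
          rw [← mul_assoc, htr]; simp only [mul_assoc]

end Gibbs

/-! ### The tracial state of the quasi-local algebra. -/

section Trace

variable {L : Type u} [DecidableEq L] {N : ℕ}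

/-- The normalized trace on `𝒜_Λ`. -/
def boxTrace (Λ : Finset L) : BoxAlgebra N Λ →ₗ[ℂ] ℂ :=
  ((N : ℂ) ^ Λ.card)⁻¹ • Matrix.traceLinearMap (Λ → Fin N) ℂ ℂ

theorem boxTrace_apply (Λ : Finset L) (A : BoxAlgebra N Λ) :
    boxTrace Λ A = ((N : ℂ) ^ Λ.card)⁻¹ * A.trace := rfl

variable [NeZero N]

theorem natCast_pow_ne_zero (n : ℕ) : (N : ℂ) ^ n ≠ 0 :=
  pow_ne_zero _ (Nat.cast_ne_zero.2 (NeZero.ne N))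

/-- The added factor `1` has trace N^(|Λ'| - |Λ|), which the normalization cancels. -/
theorem boxTrace_extend {Λ Λ' : Finset L} (h : Λ ≤ Λ') (A : BoxAlgebra N Λ) :
    boxTrace Λ' (extend h A) = boxTrace Λ A := by
  have h1 : (extend h A).trace =
      A.trace * (1 : Matrix ({x : Λ' // x.1 ∉ Λ} → Fin N) _ ℂ).trace := by
    rw [← Matrix.trace_kronecker]
    exact Equiv.sum_comp (splitConfig h) fun p =>
      (A ⊗ₖ (1 : Matrix ({x : Λ' // x.1 ∉ Λ} → Fin N) _ ℂ)) p p
  have h2 : Fintype.card {x : Λ' // x.1 ∉ Λ} = Λ'.card - Λ.card := by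
    rw [← Finset.card_sdiff_of_subset h, ← Fintype.card_coe]
    exact Fintype.card_congr
      { toFun := fun x => ⟨x.1.1, Finset.mem_sdiff.2 ⟨x.1.2, x.2⟩⟩
        invFun := fun x => ⟨⟨x.1, (Finset.mem_sdiff.1 x.2).1⟩, (Finset.mem_sdiff.1 x.2).2⟩
        left_inv := fun _ => rfl
        right_inv := fun _ => rfl }
  rw [boxTrace_apply, boxTrace_apply, h1, Matrix.trace_one, Fintype.card_fun, h2, Fintype.card_fin,
    ← Nat.sub_add_cancel (Finset.card_le_card h), pow_add, Nat.add_sub_cancel]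
  push_cast
  have h3 := natCast_pow_ne_zero (N := N) (Λ'.card - Λ.card)
  have h4 := natCast_pow_ne_zero (N := N) Λ.card
  field_simp

theorem norm_boxTrace_le (Λ : Finset L) (A : BoxAlgebra N Λ) : ‖boxTrace Λ A‖ ≤ ‖A‖ := by
  have hN : (0 : ℝ) < (N : ℝ) ^ Λ.card := pow_pos (Nat.cast_pos.2 (NeZero.pos N)) _
  rw [boxTrace_apply, norm_mul, norm_inv, norm_pow, Complex.norm_natCast, inv_mul_le_iff₀ hN]
  calc ‖A.trace‖ ≤ ∑ σ, ‖A σ σ‖ := norm_sum_le _ _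
    _ ≤ ∑ _σ : Λ → Fin N, ‖A‖ := Finset.sum_le_sum fun σ _ => by
        have h1 := sum_norm_sq_col_le A σ
        have h2 := (Finset.single_le_sum (f := fun τ => ‖A τ σ‖ ^ 2) (fun τ _ => by positivity)
          (Finset.mem_univ σ)).trans h1
        exact (pow_le_pow_iff_left₀ (norm_nonneg _) (norm_nonneg _) two_ne_zero).1 h2
    _ = _ := by simp

/-- The normalized trace on the local algebra. -/
def localTrace (L : Type u) [DecidableEq L] (N : ℕ) [NeZero N] : LocalAlgebra L N →L[ℂ] ℂ :=
  LinearMap.mkContinuous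
    { toFun := DirectLimit.lift (fun _ _ h => extend h) (fun Λ A => boxTrace Λ A)
        fun _ _ h A => (boxTrace_extend h A).symm
      map_add' := fun a b => by
        obtain ⟨Λ, A, B, rfl, rfl⟩ := LocalAlgebra.exists_mk₂ a b
        rw [← LocalAlgebra.mk_add]
        exact map_add (boxTrace Λ) A B
      map_smul' := fun c a => by
        obtain ⟨Λ, A, rfl⟩ := LocalAlgebra.exists_mk a
        rw [← LocalAlgebra.mk_smul]
        exact map_smul (boxTrace Λ) c A } 1 fun a => by
    obtain ⟨Λ, A, rfl⟩ := LocalAlgebra.exists_mk a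
    rw [one_mul]
    exact norm_boxTrace_le Λ A

theorem localTrace_mk (Λ : Finset L) (A : BoxAlgebra N Λ) :
    localTrace L N (LocalAlgebra.mk Λ A) = boxTrace Λ A := rfl

/-- The inclusion of the local observables as a bounded linear map. -/
def ofLocalCLM (L : Type u) [DecidableEq L] (N : ℕ) [NeZero N] :
    LocalAlgebra L N →L[ℂ] QuasiLocalAlgebra L N :=
  LinearMap.mkContinuous
    { toFun := QuasiLocalAlgebra.ofLocal
      map_add' := QuasiLocalAlgebra.ofLocal_add
      map_smul' := QuasiLocalAlgebra.ofLocal_smul } 1 fun a => by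
    rw [one_mul]
    exact (QuasiLocalAlgebra.norm_ofLocal a).le

/-- The quasi-local algebra has a tracial state. -/
theorem exists_tracial_state (L : Type u) [DecidableEq L] (N : ℕ) [NeZero N] :
    ∃ τ : QuasiLocalAlgebra L N →L[ℂ] ℂ, (∀ a, 0 ≤ τ (star a * a)) ∧ τ 1 = 1 ∧
      ∀ a b, τ (a * b) = τ (b * a) := by
  let τ : QuasiLocalAlgebra L N →L[ℂ] ℂ := (localTrace L N).extend (ofLocalCLM L N)
  have hiso : Isometry (ofLocalCLM L N) :=
    AddMonoidHomClass.isometry_of_norm _ QuasiLocalAlgebra.norm_ofLocal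
  have hτ : ∀ a : LocalAlgebra L N, τ (QuasiLocalAlgebra.ofLocal a) = localTrace L N a := fun a =>
    ContinuousLinearMap.extend_eq _ QuasiLocalAlgebra.denseRange_ofLocal hiso.isUniformInducing a
  refine ⟨τ, fun a => ?_, ?_, fun a b => ?_⟩
  · refine QuasiLocalAlgebra.denseRange_ofLocal.induction_on (p := fun a => 0 ≤ τ (star a * a)) a
      (isClosed_le continuous_const (by fun_prop)) fun a => ?_
    obtain ⟨Λ, A, rfl⟩ := LocalAlgebra.exists_mk a
    rw [← QuasiLocalAlgebra.ofLocal_star, ← QuasiLocalAlgebra.ofLocal_mul, hτ,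
      ← LocalAlgebra.mk_star, ← LocalAlgebra.mk_mul, localTrace_mk, boxTrace_apply]
    have h1 := (Matrix.posSemidef_conjTranspose_mul_self A).trace_nonneg
    have h2 : (0 : ℂ) ≤ ((N : ℂ) ^ Λ.card)⁻¹ := by
      have : ((N : ℂ) ^ Λ.card)⁻¹ = (((N : ℝ) ^ Λ.card)⁻¹ : ℝ) := by push_cast; rfl
      rw [this]
      exact Complex.zero_le_real.2 (by positivity)
    exact mul_nonneg h2 h1
  · rw [← QuasiLocalAlgebra.ofLocal_one, hτ, ← LocalAlgebra.mk_one ∅, localTrace_mk,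
      boxTrace_apply]
    simp
  · refine QuasiLocalAlgebra.denseRange_ofLocal.induction_on₂ (p := fun a b => τ (a * b) = τ (b * a))
      ?_ (fun a b => ?_) a b
    · exact isClosed_eq (by fun_prop) (by fun_prop)
    · obtain ⟨Λ, A, B, rfl, rfl⟩ := LocalAlgebra.exists_mk₂ a b
      simp only [← QuasiLocalAlgebra.ofLocal_mul, hτ, ← LocalAlgebra.mk_mul, localTrace_mk,
        boxTrace_apply]
      rw [Matrix.trace_mul_comm]

end Trace

/-! ### Weak-⋆ compactness. -/

section Compactness

/-- Functionals in the unit ball of the dual have a pointwise limit along an ultrafilter. -/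
theorem exists_ultrafilter_limit {E ι : Type*} [NormedAddCommGroup E] [NormedSpace ℂ E]
    (F : Filter ι) [F.NeBot] (ρ : ι → E →L[ℂ] ℂ) (hρ : ∀ i a, ‖ρ i a‖ ≤ ‖a‖) :
    ∃ (U : Ultrafilter ι) (ρ' : E →L[ℂ] ℂ), ↑U ≤ F ∧
      ∀ a, Tendsto (fun i => ρ i a) U (𝓝 (ρ' a)) := by
  let U := Ultrafilter.of F
  have hex : ∀ a, ∃ l, ‖l‖ ≤ ‖a‖ ∧ Tendsto (fun i => ρ i a) U (𝓝 l) := fun a => by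
    obtain ⟨l, hl, h⟩ := (isCompact_closedBall (0 : ℂ) ‖a‖).ultrafilter_le_nhds
      (U.map fun i => ρ i a) (le_principal_iff.2 (Ultrafilter.mem_map.2 (univ_mem' fun i => by
        simpa using hρ i a)))
    exact ⟨l, by simpa using hl, h⟩
  choose l hl hlim using hex
  refine ⟨U, LinearMap.mkContinuous
    { toFun := l
      map_add' := fun a b => tendsto_nhds_unique (hlim (a + b))
        (by simpa using (hlim a).add (hlim b))
      map_smul' := fun c a => tendsto_nhds_unique (hlim (c • a))
        (by simpa using (hlim a).const_mul c) } 1 fun a => by rw [one_mul]; exact hl a,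
    Ultrafilter.of_le F, hlim⟩

end Compactness

/-! ### Existence of KMS states and vanishing of twisted traces. -/

section KMS

attribute [local irreducible] QuasiLocalAlgebra.instCStarAlgebra

variable {L : Type u} [DecidableEq L] {N : ℕ} [NeZero N]

/-- The values of the analytic continuation at imaginary time are unique. -/
theorem IsEvolutionAtImaginaryTime.unique
    {α : ℝ → (QuasiLocalAlgebra L N ≃⋆ₐ[ℂ] QuasiLocalAlgebra L N)} {β : ℝ} (hβ : 0 ≤ β)
    {A W W' : QuasiLocalAlgebra L N} (h : IsEvolutionAtImaginaryTime α β A W)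
    (h' : IsEvolutionAtImaginaryTime α β A W') : W = W' := by
  obtain ⟨f, hf, hfα, rfl⟩ := h
  obtain ⟨g, hg, hgα, rfl⟩ := h'
  have hconv : Convex ℝ {z : ℂ | 0 ≤ z.im ∧ z.im ≤ β} :=
    (convex_halfSpace_im_ge 0).inter (convex_halfSpace_im_le β)
  refine hf.eqOn_of_preconnected_of_frequently_eq hg hconv.isPreconnected
    (z₀ := 0) (by simp [hβ]) ?_ (by simp [hβ])
  -- The real points 1/(n + 1), where both continuations equal α_t(A), accumulate at `0`.
  have ht : Tendsto (fun n : ℕ => (((1 / ((n : ℝ) + 1) : ℝ)) : ℂ)) atTop (𝓝[≠] 0) := by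
    refine tendsto_nhdsWithin_iff.2 ⟨?_, Eventually.of_forall fun n => ?_⟩
    · exact (Complex.continuous_ofReal.tendsto 0).comp
        (tendsto_one_div_add_atTop_nhds_zero_nat (𝕜 := ℝ))
    · have : (1 / ((n : ℝ) + 1) : ℝ) ≠ 0 := by positivity
      exact Complex.ofReal_ne_zero.2 this
  refine ht.frequently (Frequently.of_forall fun n => ?_)
  rw [hfα, hgα]

/-- The limits of the finite-volume evolutions of local observables give the evolution at imaginary
time. -/
theorem Interaction.exists_isEvolutionAtImaginaryTime (Φ : Interaction L N)
    (hl : HasLimitDynamics atTop (boxSum Φ.term)) {r κ β : ℝ} (hκ0 : 0 < κ) (hr : 1 < r)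
    (hκ : WeightBound (fun X => ‖Φ.term X‖) r κ) (hβ0 : 0 ≤ β) (hβ : β < (r - 1) / κ)
    {A : QuasiLocalAlgebra L N} (hA : A ∈ localObservables L N) :
    ∃ W, IsEvolutionAtImaginaryTime hl.automorphism β A W ∧
      Tendsto (fun Λ => evolution (boxSum Φ.term Λ) (Complex.I * β) A) atTop (𝓝 W) := by
  obtain ⟨Y, hY⟩ := mem_localObservables.1 hA
  obtain ⟨f, hf, hlim⟩ := Φ.isLocalInteraction.exists_tendsto_strip hl hκ0 hr hκ hY
  have hopen : IsOpen {z : ℂ | |z.im| < (r - 1) / κ} :=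
    isOpen_lt Complex.continuous_im.abs continuous_const
  have hR : 0 < (r - 1) / κ := hβ0.trans_lt hβ
  refine ⟨f (Complex.I * β), ⟨f, (hf.analyticOnNhd hopen).mono ?_, fun t => ?_, rfl⟩,
    hlim _ (by simpa [abs_of_nonneg hβ0] using hβ)⟩
  · rintro z ⟨h0, h1⟩
    exact (abs_of_nonneg h0).trans_lt (h1.trans_lt hβ)
  · exact tendsto_nhds_unique (hlim t (by simpa using hR)) (hl.tendsto t A)

/-- A limit of Gibbs states is a KMS state. -/
theorem exists_isKMSState (Φ : Interaction L N) (hl : HasLimitDynamics atTop (boxSum Φ.term))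
    {β : ℝ} (hW : ∀ A ∈ localObservables L N, ∃ W, IsEvolutionAtImaginaryTime hl.automorphism β A W ∧
      Tendsto (fun Λ => evolution (boxSum Φ.term Λ) (Complex.I * β) A) atTop (𝓝 W)) :
    ∃ ρ, IsKMSState hl.automorphism β ρ := by
  obtain ⟨τ, hpos, h1, htr⟩ := exists_tracial_state L N
  choose ρ hρpos hρ1 hρ using fun Λ => exists_gibbs_state τ hpos h1 htr (hl.isSelfAdjoint Λ) β
  have hnorm : ∀ Λ a, ‖ρ Λ a‖ ≤ ‖a‖ := fun Λ =>
    norm_apply_le_of_positive (ρ Λ) (hρpos Λ) (hρ1 Λ)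
  obtain ⟨U, ρ', hU, hlim⟩ := exists_ultrafilter_limit atTop ρ hnorm
  refine ⟨ρ', ⟨fun A => ?_, ?_⟩, fun A hA => ?_⟩
  · exact ge_of_tendsto (hlim _) (Eventually.of_forall fun Λ => hρpos Λ A)
  · refine tendsto_nhds_unique (hlim 1) ?_
    simp only [hρ1]
    exact tendsto_const_nhds
  · obtain ⟨W, hWA, hWlim⟩ := hW A hA
    refine ⟨W, hWA, fun B _ => tendsto_nhds_unique (hlim (A * B)) ?_⟩
    -- The twist still depends on `Λ`. The states are uniformly bounded, so it may be replaced by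
    -- its norm limit `W`.
    have h2 : Tendsto (fun Λ => ρ Λ (B * evolution (boxSum Φ.term Λ) (Complex.I * β) A - B * W)) U
        (𝓝 0) := by
      refine squeeze_zero_norm (fun Λ => hnorm Λ _) ?_
      have h3 := ((hWlim.mono_left hU).const_mul B).sub_const (B * W)
      rw [sub_self] at h3
      exact tendsto_zero_iff_norm_tendsto_zero.1 h3
    have h4 := h2.add (hlim (B * W))
    simpa only [map_sub, sub_add_cancel, zero_add, ← hρ] using h4

variable (D : QuasiLocalAlgebra L N →L[ℂ] ℂ)

theorem norm_apply_weyl_le {u v : QuasiLocalAlgebra L N} (hu : u ∈ weylSet L N)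
    (hv : v ∈ weylSet L N) (b : QuasiLocalAlgebra L N) : ‖D (u * b * v)‖ ≤ ‖D‖ * ‖b‖ := by
  refine (D.le_opNorm _).trans (mul_le_mul_of_nonneg_left ?_ (norm_nonneg _))
  calc ‖u * b * v‖ ≤ ‖u‖ * ‖b‖ * ‖v‖ := norm_mul₃_le
    _ ≤ 1 * ‖b‖ * 1 := by
        gcongr
        exacts [norm_le_one_of_mem_weylSet hu, norm_le_one_of_mem_weylSet hv]
    _ = ‖b‖ := by ring

theorem bddAbove_weyl (b : QuasiLocalAlgebra L N) :
    BddAbove (Set.range fun k : weylSet L N × weylSet L N => ‖D (k.1 * b * k.2)‖) :=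
  ⟨‖D‖ * ‖b‖, by rintro _ ⟨k, rfl⟩; exact norm_apply_weyl_le D k.1.2 k.2.2 b⟩

instance : Nonempty (weylSet L N) := ⟨⟨1, one_mem_weylSet⟩⟩

/-- The seminorm `b ↦ sup |D(u b v)|` over the Weyl operators `u`, `v`. -/
def weylSeminorm : Seminorm ℂ (QuasiLocalAlgebra L N) :=
  Seminorm.of (fun b => ⨆ k : weylSet L N × weylSet L N, ‖D (k.1 * b * k.2)‖)
    (fun a b => ciSup_le fun k => by
      rw [mul_add, add_mul, map_add]
      exact (norm_add_le _ _).trans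
        (add_le_add (le_ciSup (bddAbove_weyl D a) k) (le_ciSup (bddAbove_weyl D b) k)))
    (fun c a => by
      simp only [mul_smul_comm, smul_mul_assoc, map_smul, norm_smul]
      rw [Real.mul_iSup_of_nonneg (norm_nonneg c)])

theorem le_weylSeminorm {u v : QuasiLocalAlgebra L N} (hu : u ∈ weylSet L N)
    (hv : v ∈ weylSet L N) (b : QuasiLocalAlgebra L N) : ‖D (u * b * v)‖ ≤ weylSeminorm D b :=
  le_ciSup (bddAbove_weyl D b) (⟨u, hu⟩, ⟨v, hv⟩)

theorem weylSeminorm_le {b : QuasiLocalAlgebra L N} {C : ℝ}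
    (h : ∀ u ∈ weylSet L N, ∀ v ∈ weylSet L N, ‖D (u * b * v)‖ ≤ C) : weylSeminorm D b ≤ C :=
  ciSup_le fun k => h _ k.1.2 _ k.2.2

theorem continuous_weylSeminorm : Continuous (weylSeminorm D) := by
  have hq : Continuous ((‖D‖₊ • normSeminorm ℂ (QuasiLocalAlgebra L N) : Seminorm ℂ _)) := by
    have : ⇑(‖D‖₊ • normSeminorm ℂ (QuasiLocalAlgebra L N) : Seminorm ℂ _) =
        fun b => ‖D‖ * ‖b‖ := rfl
    rw [this]
    fun_prop
  exact Seminorm.continuous_of_le hq fun b =>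
    weylSeminorm_le D fun u hu v hv => norm_apply_weyl_le D hu hv b

/-- In the Weyl expansion of `A` each Weyl factor is absorbed into `u`, so only the ℓ¹-norm of the
coefficients is lost. This is the source of the weight N^|X|. -/
theorem weylSeminorm_incl_mul_le {X : Finset L} (A : BoxAlgebra N X) (b : QuasiLocalAlgebra L N) :
    weylSeminorm D (incl X A * b) ≤ ‖incl X A‖ * (N : ℝ) ^ X.card * weylSeminorm D b := by
  refine weylSeminorm_le D fun u hu v hv => ?_
  rw [norm_incl, incl_eq_sum_weyl A]
  simp only [Finset.sum_mul, Finset.mul_sum, smul_mul_assoc, mul_smul_comm, map_sum, map_smul]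
  calc ‖∑ a, ∑ ψ, weylCoeff A a ψ • D (u * (incl X (weyl a ψ) * b) * v)‖
      ≤ ∑ a, ∑ ψ, ‖weylCoeff A a ψ‖ * weylSeminorm D b := by
        refine (norm_sum_le _ _).trans (Finset.sum_le_sum fun a _ => (norm_sum_le _ _).trans
          (Finset.sum_le_sum fun ψ _ => ?_))
        rw [norm_smul, ← mul_assoc u]
        exact mul_le_mul_of_nonneg_left
          (le_weylSeminorm D (mul_mem_weylSet hu (incl_weyl_mem X a ψ)) hv b) (norm_nonneg _)
    _ = (∑ a, ∑ ψ, ‖weylCoeff A a ψ‖) * weylSeminorm D b := by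
        simp only [Finset.sum_mul]
    _ ≤ ‖A‖ * (N : ℝ) ^ X.card * weylSeminorm D b := by
        refine mul_le_mul_of_nonneg_right ?_ (apply_nonneg _ _)
        refine (sum_norm_weylCoeff_le A).trans_eq ?_
        simp [mul_comm]

theorem weylSeminorm_mul_incl_le {X : Finset L} (A : BoxAlgebra N X) (b : QuasiLocalAlgebra L N) :
    weylSeminorm D (b * incl X A) ≤ ‖incl X A‖ * (N : ℝ) ^ X.card * weylSeminorm D b := by
  refine weylSeminorm_le D fun u hu v hv => ?_
  rw [norm_incl, incl_eq_sum_weyl A]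
  simp only [Finset.sum_mul, Finset.mul_sum, smul_mul_assoc, mul_smul_comm, map_sum, map_smul]
  calc ‖∑ a, ∑ ψ, weylCoeff A a ψ • D (u * (b * incl X (weyl a ψ)) * v)‖
      ≤ ∑ a, ∑ ψ, ‖weylCoeff A a ψ‖ * weylSeminorm D b := by
        refine (norm_sum_le _ _).trans (Finset.sum_le_sum fun a _ => (norm_sum_le _ _).trans
          (Finset.sum_le_sum fun ψ _ => ?_))
        rw [norm_smul, ← mul_assoc u, mul_assoc (u * b)]
        exact mul_le_mul_of_nonneg_left
          (le_weylSeminorm D hu (mul_mem_weylSet (incl_weyl_mem X a ψ) hv) b) (norm_nonneg _)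
    _ = (∑ a, ∑ ψ, ‖weylCoeff A a ψ‖) * weylSeminorm D b := by
        simp only [Finset.sum_mul]
    _ ≤ ‖A‖ * (N : ℝ) ^ X.card * weylSeminorm D b := by
        refine mul_le_mul_of_nonneg_right ?_ (apply_nonneg _ _)
        refine (sum_norm_weylCoeff_le A).trans_eq ?_
        simp [mul_comm]

theorem weylSeminorm_le_one {w : QuasiLocalAlgebra L N} (hw : w ∈ weylSet L N) :
    weylSeminorm D w ≤ weylSeminorm D 1 :=
  weylSeminorm_le D fun u hu v hv => by
    simpa using le_weylSeminorm D (mul_mem_weylSet hu hw) hv 1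

theorem weylSet_subset_localObservables : weylSet L N ⊆ localObservables L N := by
  rintro _ ⟨Λ, a, ψ, c, -, rfl⟩
  exact mem_localObservables.2 ⟨Λ, (localNet N Λ).smul_mem (incl_mem_localNet _ _) c⟩

/-- A functional that vanishes at `1` and satisfies a twisted trace property whose twist is, on the
Weyl operators of a single site, a strict contraction away from the identity, is zero. -/
theorem eq_zero_of_twisted_trace (hD1 : D 1 = 0) {q : ℝ} (hq0 : 0 ≤ q) (hq : q < 1)
    (h : ∀ x : L, ∀ w ∈ weylSet L N, w ∈ localNet N {x} → ∃ W,
      (∀ b ∈ localObservables L N, D (w * b) = D (b * W)) ∧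
        weylSeminorm D (W - w) ≤ q * weylSeminorm D 1) : D = 0 := by
  have hM0 : 0 ≤ weylSeminorm D 1 := apply_nonneg _ _
  by_cases hM : weylSeminorm D 1 = 0
  · have hw : ∀ w ∈ weylSet L N, D w = 0 := fun w hw => by
      have := le_weylSeminorm D hw one_mem_weylSet 1
      rw [hM, mul_one, mul_one] at this
      exact norm_le_zero_iff.1 this
    have hloc : Set.EqOn D 0 (localObservables L N) := fun a ha => by
      obtain ⟨Y, A, rfl⟩ := mem_localObservables.1 ha
      change D (incl Y A) = 0
      rw [incl_eq_sum_weyl A]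
      simp [hw _ (incl_weyl_mem _ _ _)]
    exact DFunLike.coe_injective (Continuous.ext_on dense_localObservables D.continuous
      continuous_zero hloc)
  exfalso
  have hMpos : 0 < weylSeminorm D 1 := lt_of_le_of_ne hM0 (Ne.symm hM)
  have key : ∀ e ∈ weylSet L N, ‖D e‖ ≤ q * weylSeminorm D 1 := fun e he => by
    rcases exists_site_average he with ⟨c, rfl⟩ | ⟨x, ι, _, _, u, v, huv, hsum⟩
    · rw [map_smul, hD1, smul_zero, norm_zero]
      positivity
    · choose hu hv hul hvu using huv
      choose W hW hWq using fun k => h x (u k) (hu k) (hul k)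
      -- The twisted trace moves `u k` to the right as `W k`, while `e = e * v k * u k`.
      have h1 : ∀ k, D e - D (u k * e * v k) = -D (e * v k * (W k - u k)) := fun k => by
        rw [mul_assoc (u k), hW k _ (weylSet_subset_localObservables (mul_mem_weylSet he (hv k))),
          mul_sub, map_sub, mul_assoc e (v k) (u k), hvu, mul_one]
        ring
      have h2 : (Fintype.card ι : ℂ) * D e = ∑ k, -D (e * v k * (W k - u k)) := by
        simp only [← h1]
        rw [Finset.sum_sub_distrib, Finset.sum_const, ← map_sum D, hsum, map_zero, sub_zero,
          Finset.card_univ, nsmul_eq_mul]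
      have h3 : (Fintype.card ι : ℝ) * ‖D e‖ ≤ Fintype.card ι * (q * weylSeminorm D 1) := by
        calc (Fintype.card ι : ℝ) * ‖D e‖ = ‖(Fintype.card ι : ℂ) * D e‖ := by simp
          _ ≤ ∑ k, ‖-D (e * v k * (W k - u k))‖ := by rw [h2]; exact norm_sum_le _ _
          _ ≤ ∑ _k : ι, q * weylSeminorm D 1 := by
              refine Finset.sum_le_sum fun k _ => ?_
              rw [norm_neg]
              have := le_weylSeminorm D (mul_mem_weylSet he (hv k)) one_mem_weylSet (W k - u k)
              rw [mul_one] at this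
              exact this.trans (hWq k)
          _ = _ := by simp
      exact le_of_mul_le_mul_left h3 (by exact_mod_cast Fintype.card_pos)
  -- The seminorm at `1` is a supremum of `|D|` over products `u * v`, which are Weyl operators
  -- again.
  have h4 : weylSeminorm D 1 ≤ q * weylSeminorm D 1 := weylSeminorm_le D fun u hu v hv => by
    rw [mul_one]
    exact key _ (mul_mem_weylSet hu hv)
  nlinarith

end KMS

/-! ### Uniqueness and the high-temperature constants. -/

section Main

attribute [local irreducible] QuasiLocalAlgebra.instCStarAlgebra

variable {L : Type u} [DecidableEq L] {N : ℕ} [NeZero N]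

theorem Interaction.isTimeEvolution (Φ : Interaction L N)
    (hl : HasLimitDynamics atTop (boxSum Φ.term)) : Φ.IsTimeEvolution hl.automorphism where
  map_zero := hl.limitEvolution_zero
  map_add := hl.limitEvolution_add
  tendsto _ hΛ t A _ := (hl.tendsto t A).comp hΛ

/-- Countability yields one exhausting sequence of finite sets. It determines the evolution on local
observables, and automorphisms are isometric, so density finishes. -/
theorem Interaction.IsTimeEvolution.unique [Countable L] {Φ : Interaction L N}
    {α α' : ℝ → (QuasiLocalAlgebra L N ≃⋆ₐ[ℂ] QuasiLocalAlgebra L N)}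
    (h : Φ.IsTimeEvolution α) (h' : Φ.IsTimeEvolution α') : α' = α := by
  obtain ⟨Λ, hΛ⟩ := exists_seq_tendsto (atTop : Filter (Finset L))
  funext t
  have hiso : ∀ γ : QuasiLocalAlgebra L N ≃⋆ₐ[ℂ] QuasiLocalAlgebra L N, Continuous γ := fun γ =>
    (StarAlgEquiv.isometry γ).continuous
  refine DFunLike.coe_injective (Continuous.ext_on dense_localObservables (hiso _) (hiso _) ?_)
  intro A hA
  exact tendsto_nhds_unique (h'.tendsto Λ hΛ t A hA) (h.tendsto Λ hΛ t A hA)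

/-- If the evolution at imaginary time of the Weyl operators of a single site is close to the
identity, there is at most one KMS state. -/
theorem IsKMSState.unique_of_contraction
    {α : ℝ → (QuasiLocalAlgebra L N ≃⋆ₐ[ℂ] QuasiLocalAlgebra L N)} {β q : ℝ} (hβ : 0 ≤ β)
    (hq0 : 0 ≤ q) (hq : q < 1)
    (h : ∀ (D : QuasiLocalAlgebra L N →L[ℂ] ℂ) (x : L), ∀ w ∈ weylSet L N, w ∈ localNet N {x} →
      ∀ W, IsEvolutionAtImaginaryTime α β w W →
        weylSeminorm D (W - w) ≤ q * weylSeminorm D 1)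
    {ρ ρ' : QuasiLocalAlgebra L N →L[ℂ] ℂ} (hρ : IsKMSState α β ρ) (hρ' : IsKMSState α β ρ') :
    ρ = ρ' := by
  refine sub_eq_zero.1 (eq_zero_of_twisted_trace (ρ - ρ') ?_ hq0 hq fun x w hw hwx => ?_)
  · rw [sub_apply, hρ.isState.map_one, hρ'.isState.map_one, sub_self]
  · have hwl := mem_localObservables.2 ⟨_, hwx⟩
    obtain ⟨W, hW, hWb⟩ := hρ.kms w hwl
    obtain ⟨W', hW', hWb'⟩ := hρ'.kms w hwl
    -- Both states have the same twist, so their difference satisfies the twisted trace property.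
    obtain rfl := hW.unique hβ hW'
    refine ⟨W, fun b hb => ?_, h _ x w hw hwx W hW⟩
    rw [sub_apply, sub_apply, hWb b hb, hWb' b hb]

theorem Interaction.weylSeminorm_sub_le (Φ : Interaction L N)
    (D : QuasiLocalAlgebra L N →L[ℂ] ℂ) {r κ β : ℝ} (hκ0 : 0 ≤ κ)
    (hκ : WeightBound (fun X => ‖Φ.term X‖ * (N : ℝ) ^ X.card) r κ) (hβ0 : 0 ≤ β)
    (hβ : 1 + κ * β ≤ r) {x : L} {w W : QuasiLocalAlgebra L N} (hw : w ∈ weylSet L N)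
    (hwx : w ∈ localNet N {x})
    (hW : Tendsto (fun Λ => evolution (boxSum Φ.term Λ) (Complex.I * β) w) atTop (𝓝 W)) :
    weylSeminorm D (W - w) ≤ κ * β * weylSeminorm D 1 := by
  have hnorm : ‖Complex.I * (β : ℂ)‖ = β := by simp [abs_of_nonneg hβ0]
  refine le_of_tendsto (((continuous_weylSeminorm D).tendsto _).comp (hW.sub_const w))
    (Eventually.of_forall fun Λ => ?_)
  have := Φ.isLocalInteraction.seminorm_evolution_sub_le (weylSeminorm D)
    (continuous_weylSeminorm D) (c := fun X => ‖Φ.term X‖ * (N : ℝ) ^ X.card)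
    (fun X => by positivity) (fun X b => weylSeminorm_incl_mul_le D _ b)
    (fun X b => weylSeminorm_mul_incl_le D _ b) hκ0 hκ Λ hwx (Complex.I * β)
    (by rw [hnorm]; exact hβ)
  rw [hnorm] at this
  exact this.trans (mul_le_mul_of_nonneg_left (weylSeminorm_le_one D hw) (by positivity))

/-- The two forms of the high-temperature condition reduce to the second one. -/
theorem Interaction.exists_high_temperature (Φ : Interaction L N) (β : ℝ≥0)
    (hβ : (β : ℝ≥0∞) * Φ.norm (N + 1) < (2 * (N : ℝ≥0∞))⁻¹ ∨
      ∃ s : ℝ≥0, s < 1 / (N : ℝ≥0) ∧ 2 * (β : ℝ≥0∞) * Φ.norm (N * (1 + s)) < s) :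
    ∃ s : ℝ≥0, s < 1 ∧ 2 * (β : ℝ≥0∞) * Φ.norm (N * (1 + s)) < s := by
  have hN : (1 : ℝ≥0) ≤ N := by exact_mod_cast NeZero.one_le
  have hN0 : (N : ℝ≥0) ≠ 0 := by positivity
  have hN1 : 1 / (N : ℝ≥0) ≤ 1 := by rw [div_le_one (by positivity)]; exact hN
  rcases hβ with h | ⟨s, hs, h⟩
  · have h1 : 2 * (β : ℝ≥0∞) * Φ.norm (N + 1) < ((1 / N : ℝ≥0) : ℝ≥0∞) := by
      have h2 := ENNReal.mul_lt_mul_right (a := 2) two_ne_zero ENNReal.ofNat_ne_top h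
      rw [ENNReal.mul_inv (Or.inl two_ne_zero) (Or.inl ENNReal.ofNat_ne_top), ← mul_assoc,
        ← mul_assoc, ENNReal.mul_inv_cancel two_ne_zero ENNReal.ofNat_ne_top, one_mul] at h2
      rw [one_div, ENNReal.coe_inv hN0, ENNReal.coe_natCast]
      exact h2
    -- Any `s` strictly between 2β‖Φ‖_{N+1} and 1/N works, since then N(1 + s) ≤ N + 1.
    obtain ⟨s, hs1, hs2⟩ := ENNReal.lt_iff_exists_nnreal_btwn.1 h1
    have hs3 : s < 1 / (N : ℝ≥0) := by exact_mod_cast hs2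
    refine ⟨s, hs3.trans_le hN1, lt_of_le_of_lt ?_ hs1⟩
    refine mul_le_mul_right (Φ.norm_mono ?_) _
    rw [lt_div_iff₀ (by positivity)] at hs3
    rw [mul_add, mul_one, mul_comm]
    gcongr
  · exact ⟨s, hs.trans_le hN1, h⟩

/-- Weight bounds for the dynamics and for the contraction estimate. -/
theorem Interaction.exists_weightBound (Φ : Interaction L N)
    (hΦ : ∃ r : ℝ≥0, 1 < r ∧ Φ.norm r < ⊤) (β s : ℝ≥0) (hs : s < 1)
    (hβ : 2 * (β : ℝ≥0∞) * Φ.norm (N * (1 + s)) < s) :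
    ∃ r κ : ℝ, 0 < κ ∧ 1 < r ∧ WeightBound (fun X => ‖Φ.term X‖) r κ ∧ (β : ℝ) < (r - 1) / κ ∧
      (β = 0 ∨ ∃ r' : ℝ, WeightBound (fun X => ‖Φ.term X‖ * (N : ℝ) ^ X.card) r' κ ∧
        1 + κ * β ≤ r' ∧ κ * β < 1) := by
  have hm1 : ∀ {r κ : ℝ≥0}, 2 * Φ.norm r ≤ κ → WeightBound (fun X => ‖Φ.term X‖) r κ := by
    intro r κ h
    have := Φ.weightBound (m := 1) (r := r) (κ := κ) (by rwa [one_mul])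
    simpa using this
  rcases eq_or_ne β 0 with rfl | hβ0
  -- At β = 0 the condition holds even if ‖Φ‖_{N(1+s)} = ∞, since 0 · ∞ = 0, so `r` comes from `hΦ`.
  -- The summand 1 keeps κ positive.
  · obtain ⟨r, hr, hfin⟩ := hΦ
    have h2 : 2 * Φ.norm r ≠ ⊤ := ENNReal.mul_ne_top ENNReal.ofNat_ne_top hfin.ne
    have hr' : (1 : ℝ) < r := by exact_mod_cast hr
    refine ⟨r, ((2 * Φ.norm r).toNNReal + 1 : ℝ≥0), by positivity, hr', hm1 ?_, ?_, Or.inl rfl⟩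
    · push_cast
      rw [ENNReal.coe_toNNReal h2]
      exact le_self_add
    · rw [NNReal.coe_zero]
      exact div_pos (by linarith) (by positivity)
  · have h1 : 2 * Φ.norm (N * (1 + s)) < ((s / β : ℝ≥0) : ℝ≥0∞) := by
      rw [ENNReal.coe_div hβ0, ENNReal.lt_div_iff_mul_lt (Or.inl (by simpa using hβ0))
        (Or.inl ENNReal.coe_ne_top)]
      calc _ = 2 * (β : ℝ≥0∞) * Φ.norm (N * (1 + s)) := by ring
        _ < s := hβ
    -- With 2‖Φ‖_{N(1+s)} < κ < s/β one κ serves both purposes: the contraction with r' = 1 + s, as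
    -- κβ < s < 1, and the dynamics with r = N(1 + s), as r - 1 ≥ s > κβ.
    obtain ⟨κ, hκ1, hκ2⟩ := ENNReal.lt_iff_exists_nnreal_btwn.1 h1
    have hκ0 : 0 < κ := by exact_mod_cast lt_of_le_of_lt (zero_le (a := 2 * Φ.norm (N * (1 + s)))) hκ1
    have hκ3 : κ < s / β := by exact_mod_cast hκ2
    have hβpos : 0 < β := pos_iff_ne_zero.2 hβ0
    rw [lt_div_iff₀ hβpos] at hκ3
    have hκs : (κ : ℝ) * β < s := by exact_mod_cast hκ3
    have hκβ : (0 : ℝ) < κ * β := by positivity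
    have hN : (1 : ℝ) ≤ N := by exact_mod_cast NeZero.one_le
    have hs1 : (s : ℝ) < 1 := by exact_mod_cast hs
    have hr : (1 : ℝ) + s ≤ N * (1 + s) := by nlinarith
    refine ⟨((N * (1 + s) : ℝ≥0) : ℝ), κ, by positivity, ?_, hm1 hκ1.le, ?_,
      Or.inr ⟨((1 + s : ℝ≥0) : ℝ), ?_, ?_, by linarith⟩⟩
    · push_cast
      linarith
    · rw [lt_div_iff₀ (by positivity)]
      push_cast
      linarith
    · have := Φ.weightBound (m := N) (r := 1 + s) (κ := κ) hκ1.le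
      simpa using this
    · push_cast
      linarith

end Main

end QuantumLattice

end

theorem theorem2p1 (d N : ℕ) [NeZero N] (Φ : QuantumLattice.Interaction (Fin d → ℤ) N)
    (hΦ : ∃ r : ℝ≥0, 1 < r ∧ Φ.norm r < ⊤) (β : ℝ≥0)
    (hβ : (β : ℝ≥0∞) * Φ.norm (N + 1) < (2 * (N : ℝ≥0∞))⁻¹ ∨
      ∃ s : ℝ≥0, s < 1 / (N : ℝ≥0) ∧ 2 * (β : ℝ≥0∞) * Φ.norm (N * (1 + s)) < s) :
    ∃ α : ℝ → (QuantumLattice.QuasiLocalAlgebra (Fin d → ℤ) N ≃⋆ₐ[ℂ]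
        QuantumLattice.QuasiLocalAlgebra (Fin d → ℤ) N),
      Φ.IsTimeEvolution α ∧ (∀ α', Φ.IsTimeEvolution α' → α' = α) ∧
        ∃! ρ : QuantumLattice.QuasiLocalAlgebra (Fin d → ℤ) N →L[ℂ] ℂ,
          QuantumLattice.IsKMSState α β ρ := by
  open QuantumLattice in
  obtain ⟨s, hs, hsβ⟩ := Φ.exists_high_temperature β hβ
  obtain ⟨r, κ, hκ0, hr, hκ, hβr, hcontr⟩ := Φ.exists_weightBound hΦ β s hs hsβ
  have hl : HasLimitDynamics Filter.atTop (boxSum Φ.term) :=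
    Φ.isLocalInteraction.hasLimitDynamics Φ.isSelfAdjoint_term
      (by rw [← localObservables_eq]; exact dense_localObservables) hκ0 hr hκ
  have hW := fun A (hA : A ∈ localObservables (Fin d → ℤ) N) =>
    Φ.exists_isEvolutionAtImaginaryTime hl hκ0 hr hκ β.2 hβr hA
  obtain ⟨ρ, hρ⟩ := exists_isKMSState Φ hl hW
  refine ⟨hl.automorphism, Φ.isTimeEvolution hl,
    fun α' hα' => (Φ.isTimeEvolution hl).unique hα', ρ, hρ, fun ρ' hρ' => ?_⟩
  rcases hcontr with rfl | ⟨r', hκ', hr', hq⟩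
  -- At β = 0 the twist is trivial: `W = w`, so both states are traces and the contraction factor is
  -- `0`.
  · refine IsKMSState.unique_of_contraction (q := 0) le_rfl le_rfl one_pos
      (fun D x w hw hwx W hWw => ?_) hρ' hρ
    obtain ⟨f, -, hf, rfl⟩ := hWw
    have h0 : f (Complex.I * ((0 : ℝ) : ℂ)) = w := by
      have := hf 0
      rw [hl.automorphism_apply, hl.limitEvolution_zero] at this
      simpa using this
    rw [h0, sub_self, map_zero, zero_mul]
  · refine IsKMSState.unique_of_contraction (q := κ * β) β.2 (by positivity) hq
      (fun D x w hw hwx W hWw => ?_) hρ' hρ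
    obtain ⟨W', hW', hlim⟩ := hW w (mem_localObservables.2 ⟨_, hwx⟩)
    obtain rfl := hWw.unique β.2 hW'
    exact Φ.weylSeminorm_sub_le D hκ0.le hκ' β.2 hr' hw hwx hlim
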